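/- Let $N$ be a non-negative integer and let $\rho:\mathbb{R}^N\to\mathbb{R}$ be a continuous, positive, bounded, integrable function with $\rho(-x)=\rho(x)$. Let $$C_\rho(\mathbb{R}^N)=\{u:\mathbb{R}^N\to\mathbb{R}\text{ continuous}:\ \|u\|_\rho:=\sup_{x}|u(x)|\rho(x)<\infty\},$$ with the norm $\|\cdot\|_\rho$, and write $B_\rho(0,R)$ for the closed ball of radius $R$ about $0$ in $C_\rho(\mathbb{R}^N)$. Let $J:\mathbb{R}^N\to\mathbb{R}$ be non-negative, integrable and even, and put $(J*_\rho v)(x)=\int_{\mathbb{R}^N}J(x-y)v(y)\rho(y)\,dy$. Let $h:\mathbb{R}^N\to\mathbb{R}$ be bounded and differentiable with bounded derivative. Let $f:\mathbb{R}\to\mathbb{R}$ be bounded, globally Lipschitz, differentiable and strictly increasing, and suppose that $|f(s)|\le\eta|s|+K$ for all $s\in\mathbb{R}$, where $\|J\|_{L^1}\|\rho\|_\infty\eta<\delta<1$. Let $$R\ \ge\ \frac{\|J\|_{L^1}\|\rho\|_\infty\,K\|\rho\|_\infty+\|h\|_\rho}{\delta-\|J\|_{L^1}\|\rho\|_\infty\eta}.$$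 Then the equation $$\frac{du}{dt}=-u+J*_\rho(f\circ u)+h$$ generates a unique flow $T(t)$, $t\in\mathbb{R}$, on $C_\rho(\mathbb{R}^N)$: $T(0)u_0=u_0$, and $t\mapsto T(t)u_0$ is differentiable in $C_\rho(\mathbb{R}^N)$ and solves the equation on $\mathbb{R}$ for every $u_0\in C_\rho(\mathbb{R}^N)$. The set $$\mathcal{A}=\omega(B_\rho(0,R))=\bigcap_{t_0\ge0}\overline{\bigcup_{t\ge t_0}T(t)B_\rho(0,R)}$$ is a global attractor of $T$, that is, it is compact, satisfies $T(t)\mathcal{A}=\mathcal{A}$ for $t\ge0$, and attracts every bounded subset of $C_\rho(\mathbb{R}^N)$ uniformly as $t\to\infty$. Moreover, $\mathcal{A}$ is the unstable set of the set of equilibria: $$\mathcal{A}=W^u(E),\qquad E=\{u\in B_\rho(0,R):\ u=J*_\rho(f\circ u)+h\},$$ where $W^u(E)=\{u\in C_\rho(\mathbb{R}^N):\ \operatorname{dist}(T(-t)u,E)\to0\text{ as }t\to\infty\}$ (for empty $E$ this set is empty). -/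

import Mathlib

open Set Filter Topology MeasureTheory Metric
open scoped NNReal BoundedContinuousFunction

noncomputable section

/-- The space domain `ℝ^N` with its Euclidean norm and Lebesgue measure. -/
abbrev RN (N : ℕ) : Type := EuclideanSpace ℝ (Fin N)

/-- A weight function on `ℝ^N`: continuous, positive, bounded, integrable and symmetric. -/
structure Weight (N : ℕ) where
  toFun : RN N → ℝ
  continuous_toFun : Continuous toFun
  pos : ∀ x, 0 < toFun x
  bddAbove_range : BddAbove (range toFun)
  integrable_toFun : Integrable toFun
  symm : ∀ x, toFun (-x) = toFun x

namespace Weight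

variable {N : ℕ}

instance : CoeFun (Weight N) (fun _ => RN N → ℝ) := ⟨Weight.toFun⟩

/-- The supremum norm of the weight. -/
def supNorm (ρ : Weight N) : ℝ := ⨆ x, ρ x

/-- The weighted norm `sup_x |u(x)| ρ(x)` of a function. -/
def wnorm (ρ : Weight N) (u : RN N → ℝ) : ℝ := ⨆ x, |u x| * ρ x

/-- The linear space of continuous functions `u` such that `|u| ρ` is bounded. -/
def submodule (ρ : Weight N) : Submodule ℝ C(RN N, ℝ) where
  carrier := {u | ∃ C : ℝ, ∀ x, |u x| * ρ x ≤ C}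
  zero_mem' := ⟨0, fun x => by simp⟩
  add_mem' := by
    rintro u v ⟨C, hC⟩ ⟨D, hD⟩
    refine ⟨C + D, fun x => ?_⟩
    calc |(u + v) x| * ρ x ≤ (|u x| + |v x|) * ρ x :=
          mul_le_mul_of_nonneg_right (abs_add_le _ _) (ρ.pos x).le
      _ = |u x| * ρ x + |v x| * ρ x := by ring
      _ ≤ C + D := add_le_add (hC x) (hD x)
  smul_mem' := by
    rintro c u ⟨C, hC⟩
    refine ⟨|c| * C, fun x => ?_⟩
    calc |(c • u) x| * ρ x = |c| * (|u x| * ρ x) := by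
          simp [abs_mul, mul_assoc]
      _ ≤ |c| * C := mul_le_mul_of_nonneg_left (hC x) (abs_nonneg c)

end Weight

/-- The weighted space `C_ρ(ℝ^N)` of continuous functions `u` with `sup_x |u(x)| ρ(x) < ∞`. It is a
type synonym, so that it does not inherit the compact-open topology of `C(ℝ^N, ℝ)`. -/
def CRho {N : ℕ} (ρ : Weight N) : Type := ρ.submodule

namespace CRho

variable {N : ℕ} {ρ : Weight N}

instance : AddCommGroup (CRho ρ) := inferInstanceAs (AddCommGroup ρ.submodule)

instance : Module ℝ (CRho ρ) := inferInstanceAs (Module ℝ ρ.submodule)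

instance : CoeFun (CRho ρ) (fun _ => RN N → ℝ) := ⟨fun u => (u.1 : C(RN N, ℝ))⟩

/-- The linear embedding `u ↦ u ρ` of `C_ρ(ℝ^N)` into the bounded continuous functions. -/
def toBCF : CRho ρ →ₗ[ℝ] (RN N →ᵇ ℝ) where
  toFun u := BoundedContinuousFunction.ofNormedAddCommGroup (fun x => u x * ρ x)
    (u.1.continuous.mul ρ.continuous_toFun) u.2.choose
    (fun x => by
      rw [Real.norm_eq_abs, abs_mul, abs_of_pos (ρ.pos x)]
      exact u.2.choose_spec x)
  map_add' u v := by
    ext x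
    exact add_mul (u x) (v x) (ρ x)
  map_smul' c u := by
    ext x
    exact mul_assoc c (u x) (ρ x)

theorem toBCF_apply (u : CRho ρ) (x : RN N) : toBCF u x = u x * ρ x := rfl

theorem toBCF_injective : Function.Injective (toBCF : CRho ρ →ₗ[ℝ] (RN N →ᵇ ℝ)) := by
  intro u v huv
  apply Subtype.ext
  ext x
  have hx := DFunLike.congr_fun huv x
  rw [toBCF_apply, toBCF_apply] at hx
  exact mul_right_cancel₀ (ρ.pos x).ne' hx

/-- The norm of `C_ρ(ℝ^N)`; `CRho.norm_eq` below shows that it is `sup_x |u(x)| ρ(x)`. -/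
instance : NormedAddCommGroup (CRho ρ) :=
  NormedAddCommGroup.induced (CRho ρ) (RN N →ᵇ ℝ) toBCF toBCF_injective

instance : NormedSpace ℝ (CRho ρ) := NormedSpace.induced ℝ (CRho ρ) (RN N →ᵇ ℝ) toBCF

theorem norm_eq (u : CRho ρ) : ‖u‖ = ρ.wnorm u := by
  change ‖toBCF u‖ = _
  rw [BoundedContinuousFunction.norm_eq_iSup_norm]
  unfold Weight.wnorm
  congr 1
  funext x
  rw [toBCF_apply, Real.norm_eq_abs, abs_mul, abs_of_pos (ρ.pos x)]

end CRho

section Dynamics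

variable {N : ℕ}

/-- The convolution `(J *_ρ v)(x) = ∫ J(x - y) v(y) ρ(y) dy`. -/
def convRho (J : RN N → ℝ) (ρ : Weight N) (v : RN N → ℝ) (x : RN N) : ℝ :=
  ∫ y, J (x - y) * v y * ρ y

/-- `φ : ℝ → C_ρ(ℝ^N)` is a solution, defined for all times, of the evolution equation
`∂u/∂t = -u + J *_ρ (f ∘ u) + h` in the space `C_ρ(ℝ^N)`. -/
def IsSolution (J : RN N → ℝ) (ρ : Weight N) (f : ℝ → ℝ) (h : RN N → ℝ)
    (φ : ℝ → CRho ρ) : Prop :=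
  ∀ t : ℝ, ∃ v : CRho ρ, HasDerivAt φ v t ∧
    ∀ x, v x = -(φ t x) + convRho J ρ (fun y => f (φ t y)) x + h x

/-- `T` is the flow generated by the evolution equation in `C_ρ(ℝ^N)`: `t ↦ T t u₀` is the solution
with initial value `u₀`. -/
structure IsFlow (J : RN N → ℝ) (ρ : Weight N) (f : ℝ → ℝ) (h : RN N → ℝ)
    (T : ℝ → CRho ρ → CRho ρ) : Prop where
  initial : ∀ u₀, T 0 u₀ = u₀
  solution : ∀ u₀, IsSolution J ρ f h (fun t => T t u₀)

/-- The equilibria in the closed ball of radius `R`. -/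
def equilibria (J : RN N → ℝ) (ρ : Weight N) (f : ℝ → ℝ) (h : RN N → ℝ) (R : ℝ) :
    Set (CRho ρ) :=
  {u | u ∈ closedBall (0 : CRho ρ) R ∧ ∀ x, u x = convRho J ρ (fun y => f (u y)) x + h x}

/-- A global attractor: a compact invariant set that attracts all bounded sets uniformly. -/
structure IsGlobalAttractor {X : Type*} [MetricSpace X] (T : ℝ → X → X) (A : Set X) : Prop where
  isCompact : IsCompact A
  invariant : ∀ t : ℝ, 0 ≤ t → T t '' A = A
  attracts : ∀ B : Set X, Bornology.IsBounded B →
    ∀ ε > 0, ∃ t₀ : ℝ, ∀ t ≥ t₀, ∀ u ∈ B, ∃ a ∈ A, dist (T t u) a < ε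

/-- The unstable set of `S`: the points `u` such that `T(-t) u → S` as `t → ∞`. -/
def unstableSet {X : Type*} [MetricSpace X] (T : ℝ → X → X) (S : Set X) : Set X :=
  {u | ∀ ε > 0, ∃ t₀ : ℝ, ∀ t ≥ t₀, ∃ e ∈ S, dist (T (-t) u) e < ε}

end Dynamics

end

/-! Write the equation as `u' = -u + B u` with `B u = J *_ρ (f ∘ u) + h`. The map `B` is bounded and
Lipschitz on the Banach space `C_ρ`, so solutions exist for all positive and negative times, are
unique, and form a continuous flow.

Compactness. By variation of constants, `T(t)u - h = e^{-t}(u - h) + ∫_0^t e^{-(t-s)} J *_ρ f(u(s))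
ds`. Since `f` is bounded by some `M`, every value of the forcing `J *_ρ f(u)` lies below `M (J *_ρ
1)`, which vanishes at infinity, and shares a modulus of continuity coming from the `L¹`-continuity
of translations of `J`. Both bounds survive the time average, so the last term stays in one
Arzelà–Ascoli compact set (`exists_isCompact_exp_decomposition`), while the first decays uniformly
on bounded sets. Hence omega-limits of bounded sets are compact, invariant and attracting. A bounded
full orbit satisfies `sup ‖u‖ ≤ a sup ‖u‖ + b` with `a < δ < 1`, so it lies in the ball of radius
`R`. Every such omega-limit therefore lies in that ball and, being invariant, in the omega-limit of
the ball.

Gradient structure. On the attractor functions are bounded without weight, so the energy `∫ (Ψ(u) -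
h f(u)) ρ - (1/2) ∫∫ J(x-y) f(u(x)) f(u(y)) ρ(x) ρ(y)` is finite and continuous, where `Ψ' = s
f'(s)`. Evenness of `J` gives it the derivative `-∫ f'(u) (u_t)² ρ ≤ 0` along orbits. If it is
constant on an orbit, then the orbit is an equilibrium (`eq_of_integral_deriv_mul_sq_eq_zero`), and
LaSalle's argument run backwards in time gives `𝒜 ⊆ W^u(E)`. The reverse inclusion holds because
backward orbits approaching the bounded set `E` are bounded, and the attractor draws them in. -/

section ODE

/-! ### Global flows of Lipschitz vector fields. -/

variable {E : Type*} [NormedAddCommGroup E] [NormedSpace ℝ E]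

/-- Global existence for a time-dependent vector field that is Lipschitz in space, uniformly in
time, and bounded on bounded time intervals. -/
theorem exists_global_solution_of_bounded [CompleteSpace E] {v : ℝ → E → E} {K : ℝ≥0}
    (hv : ∀ t, LipschitzWith K (v t)) (hcont : ∀ x, Continuous fun t => v t x)
    {M : ℝ → ℝ≥0} (hM : ∀ r t x, |t| ≤ r → ‖v t x‖ ≤ M r) (x₀ : E) :
    ∃ φ : ℝ → E, φ 0 = x₀ ∧ ∀ t, HasDerivAt φ (v t (φ t)) t := by
  have hloc : ∀ n : ℕ, ∃ α : ℝ → E, α 0 = x₀ ∧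
      ∀ t ∈ Ioo (-(n : ℝ)) n, HasDerivAt α (v t (α t)) t := by
    intro n
    have h0 : (0 : ℝ) ∈ Icc (-(n : ℝ)) n := by simp
    -- A curve of speed at most `M n` moves at most `M n * n` in time `n`, so with this radius a
    -- single Picard step covers all of `[-n, n]`.
    have hpl : IsPicardLindelof v (⟨0, h0⟩ : Icc (-(n : ℝ)) n) x₀ (M n * n) 0 (M n) K :=
      { lipschitzOnWith := fun t _ => (hv t).lipschitzOnWith
        continuousOn := fun x _ => (hcont x).continuousOn
        norm_le := fun t ht x _ => hM n t x (abs_le.2 ht)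
        mul_max_le := by simp }
    obtain ⟨α, hα0, hα⟩ := hpl.exists_eq_forall_mem_Icc_hasDerivWithinAt₀
    exact ⟨α, hα0, fun t ht =>
      (hα t (Ioo_subset_Icc_self ht)).hasDerivAt (Icc_mem_nhds ht.1 ht.2)⟩
  choose α hα0 hα using hloc
  have hagree : ∀ m n : ℕ, ∀ t : ℝ, |t| < m → |t| < n → α m t = α n t := by
    have key : ∀ m n : ℕ, m ≤ n → ∀ t : ℝ, |t| < m → α m t = α n t := by
      intro m n hmn t ht
      have hmn' : (m : ℝ) ≤ n := by exact_mod_cast hmn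
      have hm : (0 : ℝ) < m := (abs_nonneg t).trans_lt ht
      refine ODE_solution_unique_of_mem_Ioo (v := v) (s := fun _ => univ) (t₀ := 0)
        (a := -(m : ℝ)) (b := m)
        (fun t _ => (hv t).lipschitzOnWith) ⟨by linarith, hm⟩
        (fun t ht => ⟨hα m t ht, mem_univ _⟩)
        (fun t ht => ⟨hα n t ⟨by linarith [ht.1], by linarith [ht.2]⟩, mem_univ _⟩)
        ((hα0 m).trans (hα0 n).symm) (abs_lt.1 ht)
    intro m n t hm hn
    rcases le_total m n with h | h
    · exact key m n h t hm
    · exact (key n m h t hn).symm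
  have hlt : ∀ t : ℝ, |t| < ((⌊|t|⌋₊ + 1 : ℕ) : ℝ) := fun t => by
    push_cast; exact Nat.lt_floor_add_one _
  -- The `+ 1` puts `t` in the open interval, where the two-sided derivative is available.
  refine ⟨fun t => α (⌊|t|⌋₊ + 1) t, hα0 _, fun t => ?_⟩
  refine (hα _ t (abs_lt.1 (hlt t))).congr_of_eventuallyEq ?_
  filter_upwards [(continuous_abs.tendsto t).eventually (gt_mem_nhds (hlt t))] with s hs
  exact hagree _ _ s (hlt s) hs

/-- Global existence for `u' = -u + B u` with `B` bounded and Lipschitz. -/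
theorem exists_global_solution_neg_add [CompleteSpace E] {B : E → E} {K : ℝ≥0}
    (hB : LipschitzWith K B) {M : ℝ} (hM : ∀ x, ‖B x‖ ≤ M) (x₀ : E) :
    ∃ φ : ℝ → E, φ 0 = x₀ ∧ ∀ t, HasDerivAt φ (-φ t + B (φ t)) t := by
  have hM0 : 0 ≤ M := (norm_nonneg _).trans (hM 0)
  -- The substitution `ψ = e^t φ` removes the unbounded linear term; the factors `e^t` and `e^{-t}`
  -- cancel in the Lipschitz constant.
  obtain ⟨ψ, hψ0, hψ⟩ := exists_global_solution_of_bounded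
    (v := fun t x => Real.exp t • B (Real.exp (-t) • x)) (K := K)
    (M := fun r => ⟨Real.exp r * M, by positivity⟩)
    (fun t => LipschitzWith.of_dist_le_mul fun x y => by
      rw [dist_smul₀, Real.norm_eq_abs, Real.abs_exp]
      calc Real.exp t * dist (B (Real.exp (-t) • x)) (B (Real.exp (-t) • y))
          ≤ Real.exp t * (K * dist (Real.exp (-t) • x) (Real.exp (-t) • y)) := by
            gcongr; exact hB.dist_le_mul _ _
        _ = (Real.exp t * Real.exp (-t)) * (K * dist x y) := by
            rw [dist_smul₀, Real.norm_eq_abs, Real.abs_exp]; ring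
        _ = K * dist x y := by rw [← Real.exp_add]; simp)
    (fun x => by
      have := hB.continuous
      fun_prop)
    (fun r t x ht => by
      rw [norm_smul, Real.norm_eq_abs, Real.abs_exp]
      change _ ≤ Real.exp r * M
      gcongr
      · exact (le_abs_self t).trans ht
      · exact hM _) x₀
  refine ⟨fun t => Real.exp (-t) • ψ t, by simp [hψ0], fun t => ?_⟩
  have hexp : HasDerivAt (fun t : ℝ => Real.exp (-t)) (-Real.exp (-t)) t := by
    simpa using (hasDerivAt_neg t).exp
  refine (hexp.smul (hψ t)).congr_deriv ?_
  rw [smul_smul, ← Real.exp_add]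
  simp [add_comm]

/-- A linear damped equation with bounded forcing. -/
theorem norm_sub_exp_smul_le {y g : ℝ → E} (hy : ∀ t, HasDerivAt y (-y t + g t) t)
    {b : ℝ} (hg : ∀ t, ‖g t‖ ≤ b) {t : ℝ} (ht : 0 ≤ t) :
    ‖y t - Real.exp (-t) • y 0‖ ≤ (1 - Real.exp (-t)) * b := by
  have hz : ∀ s, HasDerivAt (fun s => Real.exp s • y s - y 0) (Real.exp s • g s) s := by
    intro s
    refine (((Real.hasDerivAt_exp s).smul (hy s)).sub_const (y 0)).congr_deriv ?_
    rw [← smul_add]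
    congr 1
    abel
  have hB : ∀ s, HasDerivAt (fun s => (Real.exp s - 1) * b) (Real.exp s * b) s := fun s =>
    ((Real.hasDerivAt_exp s).sub_const 1).mul_const b
  have h := image_norm_le_of_norm_deriv_right_le_deriv_boundary (a := 0) (b := t)
    (f := fun s => Real.exp s • y s - y 0)
    (fun s _ => (hz s).continuousAt.continuousWithinAt) (fun s _ => (hz s).hasDerivWithinAt)
    (B := fun s => (Real.exp s - 1) * b) (by simp) hB
    (fun s _ => by
      rw [norm_smul, Real.norm_eq_abs, Real.abs_exp]
      exact mul_le_mul_of_nonneg_left (hg s) (Real.exp_pos s).le) (right_mem_Icc.2 ht)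
  have he : Real.exp (-t) * Real.exp t = 1 := by rw [← Real.exp_add]; simp
  calc ‖y t - Real.exp (-t) • y 0‖ = ‖Real.exp (-t) • (Real.exp t • y t - y 0)‖ := by
        rw [smul_sub, smul_smul, he, one_smul]
    _ = Real.exp (-t) * ‖Real.exp t • y t - y 0‖ := by
        rw [norm_smul, Real.norm_eq_abs, Real.abs_exp]
    _ ≤ Real.exp (-t) * ((Real.exp t - 1) * b) := by gcongr
    _ = (Real.exp (-t) * Real.exp t - Real.exp (-t)) * b := by ring
    _ = _ := by rw [he]

variable {F : E → E} {K : ℝ≥0} {T : ℝ → E → E}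

theorem flow_add_of_hasDerivAt (hF : LipschitzWith K F) (h0 : ∀ u, T 0 u = u)
    (hT : ∀ u t, HasDerivAt (fun t => T t u) (F (T t u)) t) (s t : ℝ) (u : E) :
    T (s + t) u = T s (T t u) := by
  have h : (fun s => T (s + t) u) = fun s => T s (T t u) :=
    ODE_solution_unique_univ (v := fun _ => F) (s := fun _ => univ) (K := K) (t₀ := 0)
      (fun _ => hF.lipschitzOnWith)
      (fun s => ⟨(hT u (s + t)).comp_add_const s t, mem_univ _⟩)
      (fun s => ⟨hT _ s, mem_univ _⟩) (by simp [h0])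
  exact congrFun h s

theorem dist_le_of_hasDerivAt {F : E → E} (hF : LipschitzWith K F) {φ ψ : ℝ → E}
    (hφ : ∀ t, HasDerivAt φ (F (φ t)) t) (hψ : ∀ t, HasDerivAt ψ (F (ψ t)) t) {t : ℝ}
    (ht : 0 ≤ t) : dist (φ t) (ψ t) ≤ dist (φ 0) (ψ 0) * Real.exp (K * t) := by
  simpa using dist_le_of_trajectories_ODE (v := fun _ => F) (K := K) (a := 0) (b := t)
    (fun _ => hF) (fun s _ => (hφ s).continuousAt.continuousWithinAt)
    (fun s _ => (hφ s).hasDerivWithinAt) (fun s _ => (hψ s).continuousAt.continuousWithinAt)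
    (fun s _ => (hψ s).hasDerivWithinAt) le_rfl t (right_mem_Icc.2 ht)

/-- For negative times, reverse time: `t ↦ χ (-t)` solves the equation for `-F`, which has the same
Lipschitz constant. -/
theorem dist_le_of_hasDerivAt_abs (hF : LipschitzWith K F) {φ ψ : ℝ → E}
    (hφ : ∀ t, HasDerivAt φ (F (φ t)) t) (hψ : ∀ t, HasDerivAt ψ (F (ψ t)) t) (t : ℝ) :
    dist (φ t) (ψ t) ≤ dist (φ 0) (ψ 0) * Real.exp (K * |t|) := by
  rcases le_total 0 t with ht | ht
  · rw [abs_of_nonneg ht]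
    exact dist_le_of_hasDerivAt hF hφ hψ ht
  · rw [abs_of_nonpos ht]
    have hrev : ∀ χ : ℝ → E, (∀ t, HasDerivAt χ (F (χ t)) t) →
        ∀ t, HasDerivAt (fun t => χ (-t)) (-F (χ (-t))) t := fun χ hχ t => by
      exact ((hχ (-t)).scomp t (hasDerivAt_neg t)).congr_deriv (neg_one_smul ℝ _)
    simpa using dist_le_of_hasDerivAt (F := fun x => -F x) hF.neg (hrev φ hφ) (hrev ψ hψ)
      (neg_nonneg.2 ht)

theorem continuous_flow_of_hasDerivAt (hF : LipschitzWith K F) (h0 : ∀ u, T 0 u = u)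
    (hT : ∀ u t, HasDerivAt (fun t => T t u) (F (T t u)) t) (t : ℝ) : Continuous (T t) := by
  refine (LipschitzWith.of_dist_le_mul (K := ⟨Real.exp (K * |t|), (Real.exp_pos _).le⟩)
    fun u w => ?_).continuous
  have := dist_le_of_hasDerivAt_abs hF (hT u) (hT w) t
  rw [h0, h0, mul_comm] at this
  exact this

end ODE

/-! ### Omega-limits, attractors and Lyapunov functions for abstract flows. -/

section Attractor

variable {X : Type*} [MetricSpace X] {T : ℝ → X → X}

theorem mem_omegaLimit_atTop_iff_seq {B : Set X} {a : X} :
    a ∈ omegaLimit atTop T B ↔ ∃ (t : ℕ → ℝ) (u : ℕ → X), Tendsto t atTop atTop ∧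
      (∀ n, u n ∈ B) ∧ Tendsto (fun n => T (t n) (u n)) atTop (𝓝 a) := by
  rw [mem_omegaLimit_iff_frequently]
  constructor
  · intro h
    have h1 : ∀ n : ℕ, ∃ t : ℝ, (n : ℝ) ≤ t ∧ ∃ u ∈ B, dist (T t u) a < 1 / (n + 1) := by
      intro n
      obtain ⟨t, ht, u, hu, hd⟩ :=
        frequently_atTop.1 (h (ball a (1 / (n + 1))) (ball_mem_nhds a Nat.one_div_pos_of_nat)) n
      exact ⟨t, ht, u, hu, hd⟩
    choose t ht u hu hd using h1
    refine ⟨t, u, tendsto_atTop_mono ht tendsto_natCast_atTop_atTop, hu, ?_⟩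
    rw [tendsto_iff_dist_tendsto_zero]
    exact squeeze_zero (fun _ => dist_nonneg) (fun n => (hd n).le)
      tendsto_one_div_add_atTop_nhds_zero_nat
  · rintro ⟨t, u, ht, hu, ha⟩ n hn
    exact ht.frequently ((ha.eventually hn).mono fun k hk => ⟨u k, hu k, hk⟩).frequently

/-- Orbit segments starting in a bounded set have convergent subsequences as time tends to
infinity. -/
def AsymptoticallyCompact (T : ℝ → X → X) : Prop :=
  ∀ B : Set X, Bornology.IsBounded B → ∀ (t : ℕ → ℝ) (u : ℕ → X), Tendsto t atTop atTop →
    (∀ n, u n ∈ B) → ∃ a, ∃ φ : ℕ → ℕ, StrictMono φ ∧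
      Tendsto (fun n => T (t (φ n)) (u (φ n))) atTop (𝓝 a)

/-- Diagonal choice: replace the `n`-th point by an orbit point within `1/(n+1)` of it at a time at
least `n`. Asymptotic compactness then yields a convergent subsequence. -/
theorem AsymptoticallyCompact.isCompact_omegaLimit (hac : AsymptoticallyCompact T) {B : Set X}
    (hB : Bornology.IsBounded B) : IsCompact (omegaLimit atTop T B) := by
  refine IsSeqCompact.isCompact fun a ha => ?_
  have h1 : ∀ n : ℕ, ∃ t : ℝ, (n : ℝ) ≤ t ∧ ∃ u ∈ B, dist (T t u) (a n) < 1 / (n + 1) := by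
    intro n
    obtain ⟨t, ht, u, hu, hd⟩ := frequently_atTop.1
      ((mem_omegaLimit_iff_frequently _ _ _ _).1 (ha n) (ball (a n) (1 / (n + 1)))
        (ball_mem_nhds _ Nat.one_div_pos_of_nat)) n
    exact ⟨t, ht, u, hu, hd⟩
  choose t ht u hu hd using h1
  have htt : Tendsto t atTop atTop := tendsto_atTop_mono ht tendsto_natCast_atTop_atTop
  obtain ⟨b, φ, hφ, hb⟩ := hac B hB t u htt hu
  refine ⟨b, mem_omegaLimit_atTop_iff_seq.2
    ⟨t ∘ φ, u ∘ φ, htt.comp hφ.tendsto_atTop, fun n => hu _, hb⟩, φ, hφ, ?_⟩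
  refine tendsto_of_tendsto_of_dist hb ?_
  exact squeeze_zero (fun _ => dist_nonneg) (fun n => (hd (φ n)).le)
    (tendsto_one_div_add_atTop_nhds_zero_nat.comp hφ.tendsto_atTop)

theorem AsymptoticallyCompact.omegaLimit_attracts (hac : AsymptoticallyCompact T) {B : Set X}
    (hB : Bornology.IsBounded B) {ε : ℝ} (hε : 0 < ε) :
    ∃ t₀ : ℝ, ∀ t ≥ t₀, ∀ u ∈ B, ∃ a ∈ omegaLimit atTop T B, dist (T t u) a < ε := by
  by_contra! hcon
  choose t ht u hu hd using fun n : ℕ => hcon n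
  have htt : Tendsto t atTop atTop := tendsto_atTop_mono ht tendsto_natCast_atTop_atTop
  obtain ⟨b, φ, hφ, hb⟩ := hac B hB t u htt hu
  have hbmem : b ∈ omegaLimit atTop T B := mem_omegaLimit_atTop_iff_seq.2
    ⟨t ∘ φ, u ∘ φ, htt.comp hφ.tendsto_atTop, fun n => hu _, hb⟩
  obtain ⟨n, hn⟩ := (hb.eventually (ball_mem_nhds b hε)).exists
  exact (hd (φ n) b hbmem).not_gt hn

theorem mapsTo_omegaLimit_of_add (hadd : ∀ s t u, T (s + t) u = T s (T t u))
    (hcont : ∀ t, Continuous (T t)) (B : Set X) (s : ℝ) :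
    MapsTo (T s) (omegaLimit atTop T B) (omegaLimit atTop T B) := by
  intro a ha
  obtain ⟨t, u, ht, hu, hlim⟩ := mem_omegaLimit_atTop_iff_seq.1 ha
  refine mem_omegaLimit_atTop_iff_seq.2
    ⟨fun n => s + t n, u, tendsto_atTop_add_const_left _ s ht, hu, ?_⟩
  simp_rw [hadd]
  exact ((hcont s).tendsto a).comp hlim

theorem image_eq_of_mapsTo {X : Type*} {T : ℝ → X → X} {A : Set X} (h0 : ∀ u, T 0 u = u)
    (hadd : ∀ s t u, T (s + t) u = T s (T t u)) (hA : ∀ s, MapsTo (T s) A A) (s : ℝ) :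
    T s '' A = A := by
  refine Subset.antisymm (hA s).image_subset fun a ha => ⟨T (-s) a, hA _ ha, ?_⟩
  rw [← hadd, add_neg_cancel, h0]

/-- A set that is invariant under a flow and contained in `B` is contained in the ω-limit set
of `B`. -/
theorem subset_omegaLimit_of_invariant {A B : Set X} (h0 : ∀ u, T 0 u = u)
    (hadd : ∀ s t u, T (s + t) u = T s (T t u)) (hA : ∀ s, MapsTo (T s) A A) (hAB : A ⊆ B) :
    A ⊆ omegaLimit atTop T B := fun a ha =>
  mem_omegaLimit_atTop_iff_seq.2 ⟨fun n => n, fun n => T (-n) a, tendsto_natCast_atTop_atTop,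
    fun n => hAB (hA _ ha), by simp [← hadd, h0]⟩

/-- It suffices that `S` contains all omega-limits of bounded sets; it need not absorb them in
finite time. These omega-limits are invariant under the whole flow, hence already lie in the
omega-limit of `S`. -/
theorem isGlobalAttractor_omegaLimit (hac : AsymptoticallyCompact T) (h0 : ∀ u, T 0 u = u)
    (hadd : ∀ s t u, T (s + t) u = T s (T t u)) (hcont : ∀ t, Continuous (T t)) {S : Set X}
    (hS : Bornology.IsBounded S)
    (habs : ∀ B : Set X, Bornology.IsBounded B → omegaLimit atTop T B ⊆ S) :
    IsGlobalAttractor T (omegaLimit atTop T S) where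
  isCompact := hac.isCompact_omegaLimit hS
  invariant t _ := image_eq_of_mapsTo h0 hadd (mapsTo_omegaLimit_of_add hadd hcont S) t
  attracts B hB ε hε := by
    obtain ⟨t₀, ht₀⟩ := hac.omegaLimit_attracts hB hε
    refine ⟨t₀, fun t ht u hu => ?_⟩
    obtain ⟨a, ha, hd⟩ := ht₀ t ht u hu
    exact ⟨a, subset_omegaLimit_of_invariant h0 hadd (mapsTo_omegaLimit_of_add hadd hcont B)
      (habs B hB) ha, hd⟩

/-- The unstable set of a bounded subset is contained in a closed attractor. -/
theorem unstableSet_subset_of_isGlobalAttractor {A E : Set X} (hA : IsGlobalAttractor T A)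
    (h0 : ∀ u, T 0 u = u) (hadd : ∀ s t u, T (s + t) u = T s (T t u))
    (hE : Bornology.IsBounded E) : unstableSet T E ⊆ A := by
  intro u hu
  obtain ⟨t₀, ht₀⟩ := hu 1 one_pos
  rw [← hA.isCompact.isClosed.closure_eq]
  refine Metric.mem_closure_iff.2 fun ε hε => ?_
  -- For large `s` the point `T (-s) u` lies in this bounded neighbourhood, and `T s` carries it
  -- back to `u`, so `u` is within `ε` of `A`.
  obtain ⟨t₁, ht₁⟩ := hA.attracts (thickening 1 E) hE.thickening ε hε
  have hmem : T (-max t₀ t₁) u ∈ thickening 1 E :=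
    mem_thickening_iff.2 (ht₀ _ (le_max_left _ _))
  obtain ⟨a, ha, hd⟩ := ht₁ _ (le_max_right _ _) _ hmem
  rw [← hadd, add_neg_cancel, h0] at hd
  exact ⟨a, ha, hd⟩

/-- In the presence of a continuous Lyapunov function on a compact invariant set which is constant
on an orbit only if the orbit lies in `E`, backward orbits converge to `E`. -/
theorem subset_unstableSet_of_lyapunov {A E : Set X} (hAc : IsCompact A)
    (hadd : ∀ s t u, T (s + t) u = T s (T t u)) (hcont : ∀ t, Continuous (T t))
    (hA : ∀ s, MapsTo (T s) A A) {G : X → ℝ} (hG : ContinuousOn G A)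
    (hanti : ∀ u ∈ A, Antitone fun t => G (T t u))
    (hconst : ∀ u ∈ A, (∀ s t, G (T s u) = G (T t u)) → u ∈ E) : A ⊆ unstableSet T E := by
  intro u hu
  by_contra hcon
  simp only [unstableSet, mem_ofPred_eq] at hcon
  push Not at hcon
  obtain ⟨ε, hε, hcon⟩ := hcon
  choose t ht hd using fun n : ℕ => hcon n
  have htt : Tendsto t atTop atTop := tendsto_atTop_mono ht tendsto_natCast_atTop_atTop
  obtain ⟨v, hv, φ, hφ, hlim⟩ := hAc.tendsto_subseq (x := fun n => T (-t n) u) fun n => hA _ hu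
  have hmono : Monotone fun s => G (T (-s) u) := fun s r hsr => hanti u hu (neg_le_neg hsr)
  obtain ⟨C, hC⟩ := (hAc.image_of_continuousOn hG).bddAbove
  obtain ⟨l, hl⟩ : ∃ l, Tendsto (fun s => G (T (-s) u)) atTop (𝓝 l) :=
    ⟨_, tendsto_atTop_ciSup hmono ⟨C, by
      rintro _ ⟨s, rfl⟩; exact hC (mem_image_of_mem G (hA _ hu))⟩⟩
  -- The points `T s (T (-t (φ n)) u)` lie on the orbit of `u` at times that still tend to `-∞`, so
  -- `G` has the limit `l` along them for every `s`.
  have hval : ∀ s, G (T s v) = l := by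
    intro s
    have h1 : Tendsto (fun n => T s (T (-t (φ n)) u)) atTop (𝓝[A] (T s v)) :=
      tendsto_nhdsWithin_iff.2 ⟨((hcont s).tendsto v).comp hlim,
        Eventually.of_forall fun n => hA _ (hA _ hu)⟩
    have h2 := (hG (T s v) (hA s hv)).tendsto.comp h1
    have h3 : Tendsto (fun n => t (φ n) + -s) atTop atTop :=
      tendsto_atTop_add_const_right _ _ (htt.comp hφ.tendsto_atTop)
    refine tendsto_nhds_unique h2 ((hl.comp h3).congr fun n => ?_)
    simp only [Function.comp_apply, ← hadd]
    congr 2; ring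
  have hvE : v ∈ E := hconst v hv fun s r => (hval s).trans (hval r).symm
  obtain ⟨n, hn⟩ := (hlim.eventually (ball_mem_nhds v hε)).exists
  exact (hd (φ n) v hvE).not_gt hn

end Attractor

/-! ### Completeness and compactness in the weighted space. -/

section WeightedSpace

variable {N : ℕ} {ρ : Weight N}

theorem Weight.le_supNorm (ρ : Weight N) (x : RN N) : ρ x ≤ ρ.supNorm :=
  le_ciSup ρ.bddAbove_range x

theorem Weight.supNorm_pos (ρ : Weight N) : 0 < ρ.supNorm :=
  (ρ.pos 0).trans_le (ρ.le_supNorm 0)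

namespace CRho

theorem ext_apply {u v : CRho ρ} (h : ∀ x, u x = v x) : u = v :=
  Subtype.ext (ContinuousMap.ext h)

theorem add_apply (u v : CRho ρ) (x : RN N) : (u + v) x = u x + v x := rfl

theorem neg_apply (u : CRho ρ) (x : RN N) : (-u) x = -u x := rfl

theorem sub_apply (u v : CRho ρ) (x : RN N) : (u - v) x = u x - v x := rfl

theorem smul_apply (c : ℝ) (u : CRho ρ) (x : RN N) : (c • u) x = c * u x := rfl

theorem continuous_coe (u : CRho ρ) : Continuous fun x => u x := u.1.continuous

theorem abs_mul_le_norm (u : CRho ρ) (x : RN N) : |u x| * ρ x ≤ ‖u‖ := by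
  have h := (toBCF u).norm_coe_le_norm x
  rw [toBCF_apply, Real.norm_eq_abs, abs_mul, abs_of_pos (ρ.pos x)] at h
  exact h

theorem norm_le_of_forall {u : CRho ρ} {C : ℝ} (h : ∀ x, |u x| * ρ x ≤ C) : ‖u‖ ≤ C := by
  rw [norm_eq]
  exact ciSup_le h

/-- A continuous function that is bounded against the weight, as an element of `C_ρ`. -/
def ofBound (u : RN N → ℝ) (hu : Continuous u) (h : ∃ C : ℝ, ∀ x, |u x| * ρ x ≤ C) : CRho ρ :=
  ⟨⟨u, hu⟩, h⟩

theorem isometry_toBCF : Isometry (toBCF : CRho ρ → (RN N →ᵇ ℝ)) :=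
  Isometry.of_dist_eq fun _ _ => rfl

theorem toBCF_surjective : Function.Surjective (toBCF : CRho ρ → (RN N →ᵇ ℝ)) := by
  intro g
  have hmul : ∀ x, g x / ρ x * ρ x = g x := fun x => div_mul_cancel₀ _ (ρ.pos x).ne'
  refine ⟨ofBound (fun x => g x / ρ x)
    (g.continuous.div ρ.continuous_toFun fun x => (ρ.pos x).ne') ⟨‖g‖, fun x => ?_⟩, ?_⟩
  · rw [← abs_of_pos (ρ.pos x), ← abs_mul, abs_of_pos (ρ.pos x), hmul]
    exact g.norm_coe_le_norm x
  · ext x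
    exact hmul x

instance : CompleteSpace (CRho ρ) :=
  ((IsometryEquiv.mk (Equiv.ofBijective _ ⟨toBCF_injective, toBCF_surjective⟩)
    isometry_toBCF).completeSpace_iff).2 inferInstance

/-- Evaluation at a point. -/
noncomputable def eval (ρ : Weight N) (x : RN N) : CRho ρ →L[ℝ] ℝ :=
  LinearMap.mkContinuous
    { toFun := fun u => u x
      map_add' := fun u v => add_apply u v x
      map_smul' := fun c u => smul_apply c u x } (1 / ρ x) fun u => by
    have := abs_mul_le_norm u x
    rw [div_mul_eq_mul_div, one_mul, le_div_iff₀ (ρ.pos x)]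
    exact this

end CRho

/-- Arzelà–Ascoli in `C_ρ`: functions dominated by a bounded function vanishing at infinity and
sharing a modulus of continuity form a compact set. -/
theorem CRho.isCompact_setOf_le {b : RN N → ℝ} {τ : RN N → RN N → ℝ} {C : ℝ}
    (hbC : ∀ x, b x ≤ C) (hb : Tendsto b (cocompact (RN N)) (𝓝 0))
    (hτ : ∀ x, Tendsto (τ x) (𝓝 x) (𝓝 0)) :
    IsCompact {v : CRho ρ | (∀ x, |v x| ≤ b x) ∧ ∀ x x', |v x - v x'| ≤ τ x x'} := by
  set P : (RN N → ℝ) → Prop := fun v => (∀ x, |v x| ≤ b x) ∧ ∀ x x', |v x - v x'| ≤ τ x x'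
  set S : Set C(RN N, ℝ) := {v | P v}
  have hcontP : ∀ v, P v → Continuous v := fun v hv => continuous_iff_continuousAt.2 fun x => by
    rw [ContinuousAt, tendsto_iff_dist_tendsto_zero]
    refine squeeze_zero (fun _ => dist_nonneg) (fun x' => ?_) (hτ x)
    rw [dist_comm]; exact hv.2 x x'
  -- The modulus `τ` forces continuity, so the image of `S` is cut out by pointwise closed
  -- conditions and is closed in the product topology.
  have himg : ContinuousMap.toFun '' S = {v | P v} := by
    ext v
    constructor
    · rintro ⟨w, hw, rfl⟩; exact hw
    · intro hv; exact ⟨⟨v, hcontP v hv⟩, hv, rfl⟩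
  have hS : IsCompact S := by
    refine ArzelaAscoli.isCompact_of_equicontinuous S ?_ ?_
    · rw [himg]
      refine (isCompact_univ_pi fun x : RN N => isCompact_Icc (a := -b x) (b := b x)).of_isClosed_subset
        ?_ fun v hv x _ => abs_le.1 (hv.1 x)
      simp only [P, ofPred_and, ofPred_forall]
      refine IsClosed.inter (isClosed_iInter fun x => ?_)
        (isClosed_iInter fun x => isClosed_iInter fun x' => ?_)
      · exact isClosed_le (continuous_apply x).abs continuous_const
      · exact isClosed_le ((continuous_apply x).sub (continuous_apply x')).abs continuous_const
    · intro x
      rw [Metric.equicontinuousAt_iff_right]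
      intro ε hε
      filter_upwards [(hτ x).eventually (gt_mem_nhds hε)] with x' hx' v
      exact (v.2.2 x x').trans_lt hx'
  have hmem : ∀ v : S, ∃ c : ℝ, ∀ x, |v.1 x| * ρ x ≤ c := fun v => ⟨C * ρ.supNorm, fun x => by
    have h1 := (v.2.1 x).trans (hbC x)
    exact mul_le_mul h1 (ρ.le_supNorm x) (ρ.pos x).le ((abs_nonneg _).trans h1)⟩
  let ι : S → CRho ρ := fun v => ofBound v.1 v.1.continuous (hmem v)
  have hι : Continuous ι := by
    refine continuous_iff_continuousAt.2 fun v => ?_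
    rw [ContinuousAt, Metric.tendsto_nhds]
    intro ε hε
    -- On `k` the functions differ by less than `e`; off `k` each is below `e` because `b` is. The
    -- weight itself need not vanish at infinity, so the control of the tails comes from `b`.
    set e := ε / (4 * ρ.supNorm) with he
    have hρ := ρ.supNorm_pos
    have hepos : 0 < e := by positivity
    obtain ⟨k, hk, hkb⟩ := mem_cocompact.1 (hb (gt_mem_nhds hepos))
    have hu := (ContinuousMap.tendsto_iff_forall_isCompact_tendstoUniformlyOn.1
      (continuous_subtype_val.tendsto v)) k hk
    filter_upwards [Metric.tendstoUniformlyOn_iff.1 hu e hepos] with w hw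
    have hle : ‖ι w - ι v‖ ≤ 2 * e * ρ.supNorm := norm_le_of_forall fun x => by
      change |w.1 x - v.1 x| * ρ x ≤ _
      refine mul_le_mul ?_ (ρ.le_supNorm x) (ρ.pos x).le (by positivity)
      by_cases hx : x ∈ k
      · have := hw x hx
        rw [dist_comm, Real.dist_eq] at this
        linarith
      · have h1 : b x < e := hkb hx
        have h2 := abs_sub (w.1 x) (v.1 x)
        linarith [w.2.1 x, v.2.1 x]
    rw [dist_eq_norm]
    refine hle.trans_lt ?_
    rw [he]
    field_simp
    linarith
  have := isCompact_iff_compactSpace.1 hS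
  convert isCompact_range hι
  ext v
  constructor
  · intro hv; exact ⟨⟨v.1, hv⟩, rfl⟩
  · rintro ⟨w, rfl⟩; exact w.2

end WeightedSpace

/-! ### Estimates for the weighted convolution. -/

section Convolution

variable {N : ℕ} {J : RN N → ℝ} {ρ : Weight N}

/-- The `L¹` distance between the translates of the reflected kernel at two points. -/
noncomputable def translationModulus (J : RN N → ℝ) (x x' : RN N) : ℝ :=
  ∫ y, |J (x - y) - J (x' - y)|

theorem tendsto_translationModulus_of_hasCompactSupport {g : RN N → ℝ} (hg : Continuous g)
    (hgc : HasCompactSupport g) (x : RN N) :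
    Tendsto (translationModulus g x) (𝓝 x) (𝓝 0) := by
  -- For every `x'` within distance `1` of `x`, the translate `y ↦ g (x' - y)` is supported in this
  -- one compact set.
  set k : Set (RN N) := (fun p : RN N × RN N => p.1 - p.2) '' (closedBall x 1 ×ˢ tsupport g)
  have hk : IsCompact k :=
    ((isCompact_closedBall x 1).prod hgc.isCompact).image (continuous_fst.sub continuous_snd)
  have hzero : ∀ x' ∈ closedBall x 1, ∀ y, y ∉ k → g (x' - y) = 0 := fun x' hx' y hy => by
    by_contra hne
    exact hy ⟨(x', x' - y), ⟨hx', subset_tsupport g hne⟩, sub_sub_cancel _ _⟩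
  have hcont : ContinuousOn (translationModulus g x) (closedBall x 1) := by
    refine continuousOn_integral_of_compact_support (k := k) hk (by fun_prop) ?_
    intro x' y hx' hy
    rw [hzero x' hx' y hy, hzero x (mem_closedBall_self zero_le_one) y hy]
    simp
  have h := hcont.continuousAt (closedBall_mem_nhds x one_pos)
  have h0 : translationModulus g x x = 0 := by simp [translationModulus]
  rwa [ContinuousAt, h0] at h

theorem integrable_sub_left_comp (hJ : Integrable J) (x : RN N) :
    Integrable fun y => J (x - y) :=
  hJ.comp_sub_left x

/-- Continuity of translations in `L¹`, by density of continuous compactly supported functions. -/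
theorem tendsto_translationModulus (hJ : Integrable J) (x : RN N) :
    Tendsto (translationModulus J x) (𝓝 x) (𝓝 0) := by
  rw [Metric.tendsto_nhds]
  intro ε hε
  obtain ⟨g, hgc, hgJ, hg, hgi⟩ :=
    hJ.exists_hasCompactSupport_integral_sub_le (ε := ε / 4) (by positivity)
  have hsub : ∀ z, ∫ y, |J (z - y) - g (z - y)| ≤ ε / 4 := fun z => by
    rw [integral_sub_left_eq_self (fun y => |J y - g y|) volume z]
    exact hgJ
  filter_upwards [(tendsto_translationModulus_of_hasCompactSupport hg hgc x).eventually
    (gt_mem_nhds (half_pos hε))] with x' hx'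
  have hnonneg : 0 ≤ translationModulus J x x' := integral_nonneg fun _ => abs_nonneg _
  rw [Real.dist_eq, sub_zero, abs_of_nonneg hnonneg]
  have hi : ∀ z, Integrable fun y => |J (z - y) - g (z - y)| := fun z =>
    ((integrable_sub_left_comp hJ z).sub (integrable_sub_left_comp hgi z)).abs
  have hig : Integrable fun y => |g (x - y) - g (x' - y)| :=
    ((integrable_sub_left_comp hgi x).sub (integrable_sub_left_comp hgi x')).abs
  have hle : translationModulus J x x' ≤ (∫ y, |J (x - y) - g (x - y)|) +
      (translationModulus g x x' + ∫ y, |J (x' - y) - g (x' - y)|) := by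
    unfold translationModulus
    have e1 := integral_add hig (hi x')
    have e2 := integral_add (hi x) (hig.add (hi x'))
    refine le_of_le_of_eq ?_ (e2.trans (congrArg _ e1))
    refine integral_mono
      ((integrable_sub_left_comp hJ x).sub (integrable_sub_left_comp hJ x')).abs
      ((hi x).add (hig.add (hi x'))) fun y => ?_
    change |J (x - y) - J (x' - y)| ≤ |J (x - y) - g (x - y)| +
      (|g (x - y) - g (x' - y)| + |J (x' - y) - g (x' - y)|)
    have h1 := abs_sub_le (J (x - y)) (g (x - y)) (J (x' - y))
    have h2 := abs_sub_le (g (x - y)) (g (x' - y)) (J (x' - y))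
    rw [abs_sub_comm (g (x' - y))] at h2
    linarith
  linarith [hsub x, hsub x']

theorem integrable_convRho_integrand (hJ : Integrable J) {g : RN N → ℝ} (hg : Measurable g)
    {c : ℝ} (hgc : ∀ y, |g y| * ρ y ≤ c) (x : RN N) :
    Integrable fun y => J (x - y) * g y * ρ y := by
  have h := (integrable_sub_left_comp hJ x).mul_bdd (g := fun y => g y * ρ y) (c := c)
    (hg.mul ρ.continuous_toFun.measurable).aestronglyMeasurable
    (Eventually.of_forall fun y => by
      rw [Real.norm_eq_abs]
      rw [abs_mul, abs_of_pos (ρ.pos y)]; exact hgc y)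
  simpa only [mul_assoc] using h

theorem abs_convRho_le (hJ : Integrable J) {g : RN N → ℝ} {c : ℝ} (hgc : ∀ y, |g y| * ρ y ≤ c)
    (x : RN N) : |convRho J ρ g x| ≤ (∫ y, |J y|) * c := by
  have h := norm_integral_le_of_norm_le (f := fun y => J (x - y) * g y * ρ y)
    (((integrable_sub_left_comp hJ x).abs).mul_const c) (Eventually.of_forall fun y => by
      rw [Real.norm_eq_abs, mul_assoc, abs_mul, abs_mul, abs_of_pos (ρ.pos y)]
      exact mul_le_mul_of_nonneg_left (hgc y) (abs_nonneg _))
  rw [integral_mul_const, integral_sub_left_eq_self (fun y => |J y|) volume x] at h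
  exact h

theorem convRho_sub (hJ : Integrable J) {g₁ g₂ : RN N → ℝ} (hg₁ : Measurable g₁)
    (hg₂ : Measurable g₂) {c₁ c₂ : ℝ} (hgc₁ : ∀ y, |g₁ y| * ρ y ≤ c₁)
    (hgc₂ : ∀ y, |g₂ y| * ρ y ≤ c₂) (x : RN N) :
    convRho J ρ g₁ x - convRho J ρ g₂ x = convRho J ρ (fun y => g₁ y - g₂ y) x := by
  unfold convRho
  rw [← integral_sub (integrable_convRho_integrand hJ hg₁ hgc₁ x)
    (integrable_convRho_integrand hJ hg₂ hgc₂ x)]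
  congr 1; ext y; ring

theorem abs_convRho_sub_le (hJ : Integrable J) {g : RN N → ℝ} (hg : Measurable g)
    {c : ℝ} (hgc : ∀ y, |g y| * ρ y ≤ c) (x x' : RN N) :
    |convRho J ρ g x - convRho J ρ g x'| ≤ c * translationModulus J x x' := by
  unfold convRho translationModulus
  rw [← integral_sub (integrable_convRho_integrand hJ hg hgc x)
    (integrable_convRho_integrand hJ hg hgc x'), ← integral_const_mul]
  refine norm_integral_le_of_norm_le (G := ℝ)
    (((integrable_sub_left_comp hJ x).sub (integrable_sub_left_comp hJ x')).abs.const_mul c)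
    (Eventually.of_forall fun y => ?_)
  have : J (x - y) * g y * ρ y - J (x' - y) * g y * ρ y =
    (g y * ρ y) * (J (x - y) - J (x' - y)) := by ring
  rw [Real.norm_eq_abs, this, abs_mul, abs_mul, abs_of_pos (ρ.pos y)]
  exact mul_le_mul_of_nonneg_right (hgc y) (abs_nonneg _)

theorem continuous_convRho (hJ : Integrable J) {g : RN N → ℝ} (hg : Measurable g)
    {c : ℝ} (hgc : ∀ y, |g y| * ρ y ≤ c) : Continuous (convRho J ρ g) := by
  refine continuous_iff_continuousAt.2 fun x => ?_
  rw [ContinuousAt, tendsto_iff_dist_tendsto_zero]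
  refine squeeze_zero (fun _ => dist_nonneg) (fun x' => ?_)
    (by simpa using (tendsto_translationModulus hJ x).const_mul c)
  rw [dist_comm]
  exact abs_convRho_sub_le hJ hg hgc x x'

theorem one_mul_weight_le (ρ : Weight N) {M : ℝ} {g : RN N → ℝ} (hg : ∀ y, |g y| ≤ M)
    (y : RN N) : |g y| * ρ y ≤ M * ρ.supNorm :=
  mul_le_mul (hg y) (ρ.le_supNorm y) (ρ.pos y).le ((abs_nonneg _).trans (hg y))

/-- Gives one majorant for all `g` bounded by `M`, hence tails that are uniform along every orbit.
-/
theorem abs_convRho_le_mul_convRho_one (hJ : Integrable J) (hJ0 : ∀ x, 0 ≤ J x) {g : RN N → ℝ}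
    {M : ℝ} (hg : ∀ y, |g y| ≤ M) (x : RN N) :
    |convRho J ρ g x| ≤ M * convRho J ρ (fun _ => 1) x := by
  unfold convRho
  rw [← integral_const_mul]
  have h1 : ∀ y : RN N, |(1 : ℝ)| * ρ y ≤ ρ.supNorm := fun y => by
    simpa using ρ.le_supNorm y
  refine norm_integral_le_of_norm_le (G := ℝ)
    ((integrable_convRho_integrand hJ measurable_const h1 x).const_mul M) (Eventually.of_forall fun y => ?_)
  rw [Real.norm_eq_abs, abs_mul, abs_mul, abs_of_pos (ρ.pos y), abs_of_nonneg (hJ0 _)]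
  have := mul_le_mul_of_nonneg_left (hg y) (mul_nonneg (hJ0 (x - y)) (ρ.pos y).le)
  linarith

theorem tendsto_convRho_one_of_hasCompactSupport {g : RN N → ℝ} (hg : Continuous g)
    (hgc : HasCompactSupport g) (ρ : Weight N) :
    Tendsto (convRho g ρ fun _ => 1) (cocompact (RN N)) (𝓝 0) := by
  obtain ⟨C, hC⟩ := hgc.exists_bound_of_continuous hg
  -- Dominated convergence along a filter requires a countable basis.
  have : (cocompact (RN N)).IsCountablyGenerated := by
    rw [← Metric.cobounded_eq_cocompact, ← comap_norm_atTop]; infer_instance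
  have h := tendsto_integral_filter_of_dominated_convergence (μ := (volume : Measure (RN N)))
    (l := cocompact (RN N)) (F := fun x y => g (x - y) * 1 * ρ y) (f := fun _ => (0 : ℝ))
    (fun y => C * ρ y)
    (Eventually.of_forall fun x =>
      (((hg.comp (continuous_const.sub continuous_id)).mul continuous_const).mul
        ρ.continuous_toFun).aestronglyMeasurable)
    (Eventually.of_forall fun x => Eventually.of_forall fun y => by
      rw [mul_one, norm_mul, Real.norm_of_nonneg (ρ.pos y).le]
      exact mul_le_mul_of_nonneg_right (hC _) (ρ.pos y).le)
    (ρ.integrable_toFun.const_mul C)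
    (Eventually.of_forall fun y => by
      refine tendsto_nhds_of_eventually_eq ?_
      have hk : IsCompact ((fun z => z + y) '' tsupport g) :=
        hgc.isCompact.image (continuous_id.add continuous_const)
      filter_upwards [hk.compl_mem_cocompact] with x hx
      have : g (x - y) = 0 := by
        by_contra hne
        exact hx ⟨x - y, subset_tsupport g hne, sub_add_cancel _ _⟩
      rw [this]; ring)
  rw [integral_zero] at h
  exact h

/-- An integrable kernel convolved with an integrable bounded weight: approximate `J` in `L¹` by
compactly supported `g`, for which dominated convergence with majorant `C ρ` applies. -/
theorem tendsto_convRho_one (hJ : Integrable J) (ρ : Weight N) :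
    Tendsto (convRho J ρ fun _ => 1) (cocompact (RN N)) (𝓝 0) := by
  rw [Metric.tendsto_nhds]
  intro ε hε
  have hρ := ρ.supNorm_pos
  obtain ⟨g, hgc, hgJ, hg, hgi⟩ :=
    hJ.exists_hasCompactSupport_integral_sub_le (ε := ε / (4 * ρ.supNorm)) (by positivity)
  filter_upwards [Metric.tendsto_nhds.1 (tendsto_convRho_one_of_hasCompactSupport hg hgc ρ)
    (ε / 2) (by positivity)] with x hx
  have h1 : ∀ y : RN N, |(1 : ℝ)| * ρ y ≤ ρ.supNorm := fun y => by
    simpa using ρ.le_supNorm y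
  have hsub : convRho J ρ (fun _ => 1) x - convRho g ρ (fun _ => 1) x =
      convRho (fun y => J y - g y) ρ (fun _ => 1) x := by
    unfold convRho
    rw [← integral_sub (integrable_convRho_integrand hJ measurable_const h1 x)
      (integrable_convRho_integrand hgi measurable_const h1 x)]
    congr 1; ext y; ring
  have h2 := abs_convRho_le (hJ.sub hgi) h1 x
  have h3 : (∫ y, |(J - g) y|) * ρ.supNorm ≤ ε / 4 := by
    calc (∫ y, |(J - g) y|) * ρ.supNorm ≤ ε / (4 * ρ.supNorm) * ρ.supNorm := by
          gcongr; exact hgJ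
      _ = ε / 4 := by field_simp
  rw [Real.dist_eq, sub_zero] at hx ⊢
  have h4 : |convRho (fun y => J y - g y) ρ (fun _ => 1) x| ≤ ε / 4 := h2.trans h3
  rw [← hsub] at h4
  have := abs_sub_abs_le_abs_sub (convRho J ρ (fun _ => 1) x) (convRho g ρ (fun _ => 1) x)
  linarith

end Convolution

/-! ### Long-time bounds for damped equations. -/

section DampedEquation

variable {E : Type*} [NormedAddCommGroup E] [NormedSpace ℝ E]

/-- Start at time `t - s` and let `s → ∞`: the initial value is bounded, so its contribution is
damped away. -/
theorem norm_le_of_bounded_of_hasDerivAt {y g : ℝ → E} (hy : ∀ t, HasDerivAt y (-y t + g t) t)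
    {b C : ℝ} (hg : ∀ t, ‖g t‖ ≤ b) (hC : ∀ t, ‖y t‖ ≤ C) (t : ℝ) : ‖y t‖ ≤ b := by
  have h : ∀ s : ℝ, 0 ≤ s → ‖y t‖ ≤ Real.exp (-s) * C + (1 - Real.exp (-s)) * b := by
    intro s hs
    have h1 := norm_sub_exp_smul_le (y := fun r => y (r + (t - s))) (g := fun r => g (r + (t - s)))
      (fun r => (hy (r + (t - s))).comp_add_const r (t - s)) (fun r => hg _) hs
    simp only [add_sub_cancel, zero_add] at h1
    have h2 : ‖Real.exp (-s) • y (t - s)‖ ≤ Real.exp (-s) * C := by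
      rw [norm_smul, Real.norm_eq_abs, Real.abs_exp]
      exact mul_le_mul_of_nonneg_left (hC _) (Real.exp_pos _).le
    have h3 := norm_add_le (y t - Real.exp (-s) • y (t - s)) (Real.exp (-s) • y (t - s))
    rw [sub_add_cancel] at h3
    linarith
  have hlim : Tendsto (fun s : ℝ => Real.exp (-s) * C + (1 - Real.exp (-s)) * b) atTop
      (𝓝 (0 * C + (1 - 0) * b)) :=
    (Real.tendsto_exp_neg_atTop_nhds_zero.mul_const C).add
      ((tendsto_const_nhds.sub Real.tendsto_exp_neg_atTop_nhds_zero).mul_const b)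
  have := ge_of_tendsto hlim ((eventually_ge_atTop 0).mono h)
  simpa using this

/-- The supremum `m` of the norm is finite and satisfies `m ≤ a * m + b`. -/
theorem norm_le_div_of_bounded_of_hasDerivAt {y g : ℝ → E}
    (hy : ∀ t, HasDerivAt y (-y t + g t) t) {a b C : ℝ} (ha : 0 ≤ a) (ha1 : a < 1)
    (hg : ∀ t, ‖g t‖ ≤ a * ‖y t‖ + b) (hC : ∀ t, ‖y t‖ ≤ C) (t : ℝ) :
    ‖y t‖ ≤ b / (1 - a) := by
  have hbdd : BddAbove (range fun t => ‖y t‖) := ⟨C, by rintro _ ⟨t, rfl⟩; exact hC t⟩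
  set m := ⨆ t, ‖y t‖ with hm
  have hle : ∀ t, ‖y t‖ ≤ m := fun t => le_ciSup hbdd t
  have h1 : m ≤ a * m + b := ciSup_le fun t =>
    norm_le_of_bounded_of_hasDerivAt hy (fun s => (hg s).trans (by
      have := mul_le_mul_of_nonneg_left (hle s) ha
      linarith)) hle t
  refine (hle t).trans ?_
  rw [le_div_iff₀ (by linarith)]
  linarith

theorem asymptoticallyCompact_of_exp_decomposition {T : ℝ → E → E} {p : E} {k : Set E}
    (hk : IsCompact k)
    (hT : ∀ t, 0 ≤ t → ∀ u, (T t u - p) - Real.exp (-t) • (u - p) ∈ k) :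
    AsymptoticallyCompact T := by
  intro B hB t u ht hu
  -- The first few times may be negative, while the decomposition holds only for `t ≥ 0`.
  have ht0 : Tendsto (fun n => max (t n) 0) atTop atTop :=
    tendsto_atTop_mono (fun n => le_max_left _ _) ht
  obtain ⟨c, hc, φ, hφ, hlim⟩ := hk.tendsto_subseq
    (x := fun n => (T (max (t n) 0) (u n) - p) - Real.exp (-max (t n) 0) • (u n - p))
    fun n => hT _ (le_max_right _ _) _
  obtain ⟨C, hC⟩ := hB.exists_norm_le
  have hz : Tendsto (fun n => Real.exp (-max (t n) 0) • (u n - p)) atTop (𝓝 0) := by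
    refine squeeze_zero_norm (a := fun n => Real.exp (-max (t n) 0) * (C + ‖p‖)) (fun n => ?_) ?_
    · rw [norm_smul, Real.norm_eq_abs, Real.abs_exp]
      have := norm_sub_le (u n) p
      have := hC _ (hu n)
      gcongr
      linarith
    · simpa using (Real.tendsto_exp_neg_atTop_nhds_zero.comp ht0).mul_const (C + ‖p‖)
  refine ⟨c + 0 + p, φ, hφ, ?_⟩
  have h := (hlim.add (hz.comp hφ.tendsto_atTop)).add_const p
  refine h.congr' ?_
  filter_upwards [(ht.comp hφ.tendsto_atTop).eventually_ge_atTop 0] with n hn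
  simp only [Function.comp_apply] at hn ⊢
  rw [max_eq_left hn]
  abel

end DampedEquation

/-! ### The nonlocal nonlinearity as a map of the weighted space. -/

section Forcing

variable {N : ℕ} {J : RN N → ℝ} {ρ : Weight N} {f : ℝ → ℝ} {h : RN N → ℝ}

theorem exists_nonlocalForcing (hJ : Integrable J) (hf : Continuous f) {M : ℝ}
    (hM : ∀ s, |f s| ≤ M) (hh : Continuous h) {H : ℝ} (hH : ∀ x, |h x| ≤ H) :
    ∃ B : CRho ρ → CRho ρ, ∀ u x, B u x = convRho J ρ (fun y => f (u y)) x + h x := by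
  have hmeas : ∀ u : CRho ρ, Measurable fun y => f (u y) := fun u =>
    (hf.comp u.continuous_coe).measurable
  have hbd : ∀ u : CRho ρ, ∀ y, |f (u y)| * ρ y ≤ M * ρ.supNorm := fun u =>
    one_mul_weight_le ρ fun y => hM (u y)
  refine ⟨fun u => CRho.ofBound (fun x => convRho J ρ (fun y => f (u y)) x + h x)
    ((continuous_convRho hJ (hmeas u) (hbd u)).add hh)
    ⟨((∫ y, |J y|) * (M * ρ.supNorm) + H) * ρ.supNorm, one_mul_weight_le ρ fun x => ?_⟩,
    fun u x => rfl⟩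
  exact (abs_add_le _ _).trans (add_le_add (abs_convRho_le hJ (hbd u) x) (hH x))

variable {B : CRho ρ → CRho ρ}

theorem abs_nonlocalForcing_le (hJ : Integrable J) {M : ℝ} (hM : ∀ s, |f s| ≤ M) {H : ℝ}
    (hH : ∀ x, |h x| ≤ H) (hB : ∀ u x, B u x = convRho J ρ (fun y => f (u y)) x + h x)
    (u : CRho ρ) (x : RN N) : |B u x| ≤ (∫ y, |J y|) * (M * ρ.supNorm) + H := by
  rw [hB]
  exact (abs_add_le _ _).trans
    (add_le_add (abs_convRho_le hJ (one_mul_weight_le ρ fun y => hM (u y)) x) (hH x))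

theorem norm_nonlocalForcing_le (hJ : Integrable J) {M : ℝ} (hM : ∀ s, |f s| ≤ M) {H : ℝ}
    (hH : ∀ x, |h x| ≤ H) (hB : ∀ u x, B u x = convRho J ρ (fun y => f (u y)) x + h x)
    (u : CRho ρ) : ‖B u‖ ≤ ((∫ y, |J y|) * (M * ρ.supNorm) + H) * ρ.supNorm :=
  CRho.norm_le_of_forall (one_mul_weight_le ρ (abs_nonlocalForcing_le hJ hM hH hB u))

theorem norm_nonlocalForcing_le_affine (hJ : Integrable J) {η K : ℝ}
    (hη : 0 ≤ η) (hK : 0 ≤ K) (hf : ∀ s, |f s| ≤ η * |s| + K) {H : ℝ} (hH : ∀ x, |h x| ≤ H)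
    (hB : ∀ u x, B u x = convRho J ρ (fun y => f (u y)) x + h x) (u : CRho ρ) :
    ‖B u‖ ≤ (∫ x, |J x|) * ρ.supNorm * η * ‖u‖ +
      ((∫ x, |J x|) * ρ.supNorm * (K * ρ.supNorm) + ρ.wnorm h) := by
  refine CRho.norm_le_of_forall fun x => ?_
  have h1 : ∀ y, |f (u y)| * ρ y ≤ η * ‖u‖ + K * ρ.supNorm := fun y => by
    have h2 := mul_le_mul_of_nonneg_right (hf (u y)) (ρ.pos y).le
    have h3 := mul_le_mul_of_nonneg_left (u.abs_mul_le_norm y) hη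
    have h4 := mul_le_mul_of_nonneg_left (ρ.le_supNorm y) hK
    linarith
  have hJn : 0 ≤ ∫ y, |J y| := integral_nonneg fun _ => abs_nonneg _
  have hc : 0 ≤ (∫ y, |J y|) * (η * ‖u‖ + K * ρ.supNorm) := by
    have := ρ.supNorm_pos
    positivity
  have hw : |h x| * ρ x ≤ ρ.wnorm h :=
    le_ciSup (f := fun x => |h x| * ρ x)
      ⟨H * ρ.supNorm, by rintro _ ⟨x, rfl⟩; exact one_mul_weight_le ρ hH x⟩ x
  rw [hB]
  calc |convRho J ρ (fun y => f (u y)) x + h x| * ρ x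
      ≤ (|convRho J ρ (fun y => f (u y)) x| + |h x|) * ρ x :=
        mul_le_mul_of_nonneg_right (abs_add_le _ _) (ρ.pos x).le
    _ = |convRho J ρ (fun y => f (u y)) x| * ρ x + |h x| * ρ x := add_mul _ _ _
    _ ≤ (∫ y, |J y|) * (η * ‖u‖ + K * ρ.supNorm) * ρ.supNorm + ρ.wnorm h :=
        add_le_add (mul_le_mul (abs_convRho_le hJ h1 x) (ρ.le_supNorm x) (ρ.pos x).le hc) hw
    _ = _ := by ring

/-- The weight inside the convolution turns the pointwise bound for `f` into one by `‖u - v‖`; the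
outer weight costs the factor `ρ.supNorm`. -/
theorem lipschitzWith_nonlocalForcing (hJ : Integrable J) {M : ℝ} (hM : ∀ s, |f s| ≤ M) {L : ℝ≥0}
    (hL : LipschitzWith L f) (hB : ∀ u x, B u x = convRho J ρ (fun y => f (u y)) x + h x) :
    ∃ K : ℝ≥0, LipschitzWith K B := by
  have hJn : 0 ≤ ∫ y, |J y| := integral_nonneg fun _ => abs_nonneg _
  refine ⟨⟨(∫ y, |J y|) * L * ρ.supNorm, by have := ρ.supNorm_pos; positivity⟩,
    LipschitzWith.of_dist_le_mul fun u v => ?_⟩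
  rw [dist_eq_norm, dist_eq_norm]
  refine CRho.norm_le_of_forall fun x => ?_
  have hbd : ∀ u : CRho ρ, ∀ y, |f (u y)| * ρ y ≤ M * ρ.supNorm := fun u =>
    one_mul_weight_le ρ fun y => hM (u y)
  have hmeas : ∀ u : CRho ρ, Measurable fun y => f (u y) := fun u =>
    (hL.continuous.comp u.continuous_coe).measurable
  have h1 : ∀ y, |f (u y) - f (v y)| * ρ y ≤ L * ‖u - v‖ := fun y => by
    have h2 := hL.dist_le_mul (u y) (v y)
    rw [Real.dist_eq, Real.dist_eq] at h2
    have h3 := mul_le_mul_of_nonneg_left ((u - v).abs_mul_le_norm y) L.coe_nonneg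
    rw [CRho.sub_apply] at h3
    have h4 := mul_le_mul_of_nonneg_right h2 (ρ.pos y).le
    linarith
  rw [CRho.sub_apply, hB, hB, add_sub_add_right_eq_sub,
    convRho_sub hJ (hmeas u) (hmeas v) (hbd u) (hbd v)]
  calc _ ≤ (∫ y, |J y|) * (L * ‖u - v‖) * ρ.supNorm :=
        one_mul_weight_le ρ (abs_convRho_le hJ h1) x
    _ = (∫ y, |J y|) * L * ρ.supNorm * ‖u - v‖ := by ring

theorem isSolution_iff_hasDerivAt (hB : ∀ u x, B u x = convRho J ρ (fun y => f (u y)) x + h x)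
    {φ : ℝ → CRho ρ} :
    IsSolution J ρ f h φ ↔ ∀ t, HasDerivAt φ (-φ t + B (φ t)) t := by
  refine forall_congr' fun t => ⟨?_, fun hd => ⟨_, hd, fun x => ?_⟩⟩
  · rintro ⟨v, hv, hvx⟩
    convert hv
    refine CRho.ext_apply fun x => ?_
    rw [CRho.add_apply, CRho.neg_apply, hB, hvx, add_assoc]
  · rw [CRho.add_apply, CRho.neg_apply, hB, add_assoc]

theorem hasDerivAt_apply_of_hasDerivAt {φ : ℝ → CRho ρ} {v : CRho ρ} {t : ℝ}
    (hφ : HasDerivAt φ v t) (x : RN N) : HasDerivAt (fun t => φ t x) (v x) t :=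
  ((CRho.eval ρ x).hasFDerivAt.comp_hasDerivAt t hφ)

/-- Subtracting `p = h`, which need not decay, leaves the forcing `J *_ρ f(φ)`. The scalar damped
estimate at each point `x` transfers its decay bound, and at each pair `x, x'` its modulus of
continuity. -/
theorem exists_isCompact_exp_decomposition (hJ : Integrable J) (hJ0 : ∀ x, 0 ≤ J x)
    (hf : Continuous f) {M : ℝ} (hM : ∀ s, |f s| ≤ M) (hh : Continuous h) {H : ℝ}
    (hH : ∀ x, |h x| ≤ H) (hB : ∀ u x, B u x = convRho J ρ (fun y => f (u y)) x + h x) :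
    ∃ (p : CRho ρ) (k : Set (CRho ρ)), IsCompact k ∧ ∀ φ : ℝ → CRho ρ,
      (∀ t, HasDerivAt φ (-φ t + B (φ t)) t) → ∀ t, 0 ≤ t →
        (φ t - p) - Real.exp (-t) • (φ 0 - p) ∈ k := by
  have hM0 : 0 ≤ M := (abs_nonneg _).trans (hM 0)
  have hρ := ρ.supNorm_pos
  set p : CRho ρ := CRho.ofBound h hh ⟨H * ρ.supNorm, one_mul_weight_le ρ hH⟩
  set c := M * ρ.supNorm
  have hbd : ∀ u : CRho ρ, ∀ y, |f (u y)| * ρ y ≤ c := fun u =>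
    one_mul_weight_le ρ fun y => hM (u y)
  have hmeas : ∀ u : CRho ρ, Measurable fun y => f (u y) := fun u =>
    (hf.comp u.continuous_coe).measurable
  have h1 : ∀ y : RN N, |(1 : ℝ)| * ρ y ≤ ρ.supNorm := fun y => by
    simpa using ρ.le_supNorm y
  refine ⟨p, {v | (∀ x, |v x| ≤ M * convRho J ρ (fun _ => 1) x) ∧
      ∀ x x', |v x - v x'| ≤ c * translationModulus J x x'},
    CRho.isCompact_setOf_le (C := M * ((∫ y, |J y|) * ρ.supNorm))
      (fun x => mul_le_mul_of_nonneg_left ((le_abs_self _).trans (abs_convRho_le hJ h1 x)) hM0)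
      (by simpa using (tendsto_convRho_one hJ ρ).const_mul M)
      (fun x => by simpa using (tendsto_translationModulus hJ x).const_mul c), ?_⟩
  intro φ hφ t ht
  have hx : ∀ x s, HasDerivAt (fun s => φ s x - h x)
      (-(φ s x - h x) + convRho J ρ (fun y => f (φ s y)) x) s := fun x s => by
    refine ((hasDerivAt_apply_of_hasDerivAt (hφ s) x).sub_const (h x)).congr_deriv ?_
    rw [CRho.add_apply, CRho.neg_apply, hB]; ring
  have hval : ∀ x, ((φ t - p) - Real.exp (-t) • (φ 0 - p) : CRho ρ) x =
      (φ t x - h x) - Real.exp (-t) * (φ 0 x - h x) := fun x => rfl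
  have hexp : Real.exp (-t) ≤ 1 := Real.exp_le_one_iff.2 (by linarith)
  have hle : ∀ b : ℝ, 0 ≤ b → (1 - Real.exp (-t)) * b ≤ b := fun b hb =>
    mul_le_of_le_one_left hb (by linarith [Real.exp_pos (-t)])
  refine ⟨fun x => ?_, fun x x' => ?_⟩
  · rw [hval]
    have hg := fun s => abs_convRho_le_mul_convRho_one (ρ := ρ) hJ hJ0 (fun y => hM (φ s y)) x
    exact (norm_sub_exp_smul_le (hx x) hg ht).trans (hle _ ((abs_nonneg _).trans (hg 0)))
  · rw [hval, hval]
    have hg := fun s => abs_convRho_sub_le hJ (hmeas (φ s)) (hbd (φ s)) x x'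
    have hd : ∀ s, HasDerivAt (fun s => (φ s x - h x) - (φ s x' - h x'))
        (-((φ s x - h x) - (φ s x' - h x')) + (convRho J ρ (fun y => f (φ s y)) x -
          convRho J ρ (fun y => f (φ s y)) x')) s := fun s =>
      ((hx x s).sub (hx x' s)).congr_deriv (by ring)
    refine le_trans (le_of_eq ?_)
      ((norm_sub_exp_smul_le hd hg ht).trans (hle _ ((abs_nonneg _).trans (hg 0))))
    rw [Real.norm_eq_abs, smul_eq_mul]
    congr 1; ring

end Forcing

/-! ### Differentiation and continuity of weighted integrals. -/

section WeightedIntegral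

variable {α : Type*} [MeasurableSpace α] {μ : Measure α} {W : α → ℝ}

theorem hasDerivAt_integral_mul_weight (hW : Integrable W μ) {F F' : ℝ → α → ℝ}
    (hF : ∀ t, Measurable (F t)) (hF' : ∀ t, Measurable (F' t))
    (hd : ∀ t a, HasDerivAt (fun t => F t a) (F' t a) t) {C C' : ℝ} (hC : ∀ t a, |F t a| ≤ C)
    (hC' : ∀ t a, |F' t a| ≤ C') (t : ℝ) :
    HasDerivAt (fun t => ∫ a, F t a * W a ∂μ) (∫ a, F' t a * W a ∂μ) t := by
  refine (hasDerivAt_integral_of_dominated_loc_of_deriv_le (F := fun t a => F t a * W a)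
    (F' := fun t a => F' t a * W a) (bound := fun a => C' * ‖W a‖) (s := univ) univ_mem
    (Eventually.of_forall fun s => (hF s).aestronglyMeasurable.mul hW.aestronglyMeasurable)
    (hW.bdd_mul (hF t).aestronglyMeasurable (Eventually.of_forall (hC t)))
    ((hF' t).aestronglyMeasurable.mul hW.aestronglyMeasurable)
    (Eventually.of_forall fun a s _ => ?_) (hW.norm.const_mul C')
    (Eventually.of_forall fun a s _ => (hd s a).mul_const (W a))).2
  rw [norm_mul]
  exact mul_le_mul_of_nonneg_right (hC' s a) (norm_nonneg _)

theorem continuousOn_integral_mul_weight {X : Type*} [TopologicalSpace X]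
    [FirstCountableTopology X] {A : Set X} (hW : Integrable W μ) {F : X → α → ℝ}
    (hF : ∀ u, Measurable (F u)) (hc : ∀ a, ContinuousOn (fun u => F u a) A) {C : ℝ}
    (hC : ∀ u ∈ A, ∀ a, |F u a| ≤ C) : ContinuousOn (fun u => ∫ a, F u a * W a ∂μ) A := by
  refine continuousOn_of_dominated (bound := fun a => C * ‖W a‖)
    (fun u _ => (hF u).aestronglyMeasurable.mul hW.aestronglyMeasurable)
    (fun u hu => Eventually.of_forall fun a => ?_) (hW.norm.const_mul C)
    (Eventually.of_forall fun a => (hc a).mul continuousOn_const)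
  rw [norm_mul]
  exact mul_le_mul_of_nonneg_right (hC u hu a) (norm_nonneg _)

end WeightedIntegral

/-! ### The energy and its dissipation. -/

section Lyapunov

variable {N : ℕ} {J : RN N → ℝ} {ρ : Weight N} {f : ℝ → ℝ} {h : RN N → ℝ}

/-- The weight of the quadratic part of the Lyapunov functional. -/
def interactionWeight (J : RN N → ℝ) (ρ : Weight N) (p : RN N × RN N) : ℝ :=
  J (p.1 - p.2) * ρ p.2 * ρ p.1

theorem integrable_interactionWeight (hJ : Integrable J) (ρ : Weight N) :
    Integrable (interactionWeight J ρ) (volume.prod volume) := by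
  have h1 := ρ.integrable_toFun.convolution_integrand (ContinuousLinearMap.mul ℝ ℝ) hJ
  have h2 := h1.mul_bdd (g := fun p : RN N × RN N => ρ p.1) (c := ρ.supNorm)
    (ρ.continuous_toFun.comp continuous_fst).aestronglyMeasurable
    (Eventually.of_forall fun p => by
      rw [Real.norm_of_nonneg (ρ.pos _).le]; exact ρ.le_supNorm _)
  refine h2.congr (Eventually.of_forall fun p => ?_)
  simp only [ContinuousLinearMap.mul_apply', interactionWeight]
  ring

theorem integral_mul_interactionWeight (hJ : Integrable J) {g₁ g₂ : RN N → ℝ}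
    (hg₁ : Measurable g₁) (hg₂ : Measurable g₂) {M₁ M₂ : ℝ} (h₁ : ∀ x, |g₁ x| ≤ M₁)
    (h₂ : ∀ x, |g₂ x| ≤ M₂) :
    Integrable (fun p : RN N × RN N => g₁ p.1 * g₂ p.2 * interactionWeight J ρ p)
      (volume.prod volume) ∧
    ∫ p : RN N × RN N, g₁ p.1 * g₂ p.2 * interactionWeight J ρ p ∂(volume.prod volume) =
      ∫ x, g₁ x * convRho J ρ g₂ x * ρ x := by
  have hi : Integrable (fun p : RN N × RN N => g₁ p.1 * g₂ p.2 * interactionWeight J ρ p)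
      (volume.prod volume) :=
    (integrable_interactionWeight hJ ρ).bdd_mul (c := M₁ * M₂)
      ((hg₁.comp measurable_fst).mul (hg₂.comp measurable_snd)).aestronglyMeasurable
      (Eventually.of_forall fun p => by
        rw [Real.norm_eq_abs, abs_mul]
        exact mul_le_mul (h₁ _) (h₂ _) (abs_nonneg _) ((abs_nonneg _).trans (h₁ p.1)))
  refine ⟨hi, ?_⟩
  rw [integral_prod _ hi]
  congr 1; ext x
  unfold convRho
  rw [mul_right_comm, ← integral_const_mul]
  congr 1; ext y
  simp only [interactionWeight]
  ring

theorem integral_mul_interactionWeight_swap (hJe : ∀ x, J (-x) = J x) (g₁ g₂ : RN N → ℝ) :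
    ∫ p : RN N × RN N, g₁ p.1 * g₂ p.2 * interactionWeight J ρ p ∂(volume.prod volume) =
      ∫ p : RN N × RN N, g₂ p.1 * g₁ p.2 * interactionWeight J ρ p ∂(volume.prod volume) := by
  rw [← integral_prod_swap]
  congr 1; ext p
  simp only [interactionWeight, Prod.fst_swap, Prod.snd_swap]
  rw [← hJe (p.2 - p.1), neg_sub]
  ring

/-- The function with derivative `s * f' s`. -/
noncomputable def potential (f : ℝ → ℝ) (s : ℝ) : ℝ := s * f s - ∫ r in (0 : ℝ)..s, f r

theorem hasDerivAt_potential (hf : Differentiable ℝ f) (s : ℝ) :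
    HasDerivAt (potential f) (s * deriv f s) s := by
  have h1 := (hasDerivAt_id s).mul (hf s).hasDerivAt
  have h2 := intervalIntegral.integral_hasDerivAt_right
    (hf.continuous.intervalIntegrable 0 s)
    (hf.continuous.stronglyMeasurableAtFilter _ _) hf.continuous.continuousAt
  exact (h1.sub h2).congr_deriv (by simp)

theorem abs_potential_le {M : ℝ} (hM : ∀ s, |f s| ≤ M) (s : ℝ) :
    |potential f s| ≤ |s| * M + M * |s| := by
  unfold potential
  refine (abs_sub _ _).trans (add_le_add ?_ ?_)
  · rw [abs_mul]
    exact mul_le_mul_of_nonneg_left (hM s) (abs_nonneg s)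
  · have := intervalIntegral.norm_integral_le_of_norm_le_const (a := 0) (b := s) (f := f) (C := M)
      fun r _ => hM r
    rwa [sub_zero] at this

/-- The Lyapunov functional
`∫ (Ψ(u) - h f(u)) ρ - (1/2) ∫∫ J(x - y) f(u(x)) f(u(y)) ρ(x) ρ(y)`. -/
noncomputable def lyapunov (J : RN N → ℝ) (ρ : Weight N) (f : ℝ → ℝ) (h : RN N → ℝ)
    (u : CRho ρ) : ℝ :=
  (∫ x, (potential f (u x) - h x * f (u x)) * ρ x) -
    1 / 2 * ∫ p : RN N × RN N, f (u p.1) * f (u p.2) * interactionWeight J ρ p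
      ∂(volume.prod volume)

/-- A uniform unweighted bound on `A` is needed: for general `u` in `C_ρ` only `|u| ρ` is bounded,
which does not make `potential f (u x) * ρ x` integrable. -/
theorem continuousOn_lyapunov (hJ : Integrable J) (hf : Differentiable ℝ f) {M : ℝ}
    (hM : ∀ s, |f s| ≤ M) (hh : Continuous h) {H : ℝ} (hH : ∀ x, |h x| ≤ H)
    {A : Set (CRho ρ)} {C : ℝ} (hA : ∀ u ∈ A, ∀ x, |u x| ≤ C) :
    ContinuousOn (lyapunov J ρ f h) A := by
  have hM0 : 0 ≤ M := (abs_nonneg _).trans (hM 0)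
  have hΨ : Continuous (potential f) :=
    continuous_iff_continuousAt.2 fun s => (hasDerivAt_potential hf s).continuousAt
  have hev : ∀ x, Continuous fun u : CRho ρ => u x := fun x => (CRho.eval ρ x).continuous
  have hcu : ∀ u : CRho ρ, Continuous fun x => u x := fun u => u.continuous_coe
  have hfc := hf.continuous
  refine ContinuousOn.sub ?_ (continuousOn_const.mul ?_)
  · refine continuousOn_integral_mul_weight ρ.integrable_toFun
      (F := fun (u : CRho ρ) x => potential f (u x) - h x * f (u x))
      (fun u => ((hΨ.comp (hcu u)).sub (hh.mul (hfc.comp (hcu u)))).measurable)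
      (fun x => ((hΨ.comp (hev x)).sub (continuous_const.mul (hfc.comp (hev x)))).continuousOn)
      (C := (C * M + M * C) + H * M) fun u hu x => ?_
    refine (abs_sub _ _).trans (add_le_add ((abs_potential_le hM _).trans ?_) ?_)
    · have := hA u hu x
      gcongr
    · rw [abs_mul]
      exact mul_le_mul (hH x) (hM _) (abs_nonneg _) ((abs_nonneg _).trans (hH x))
  · refine continuousOn_integral_mul_weight (integrable_interactionWeight hJ ρ)
      (F := fun (u : CRho ρ) (p : RN N × RN N) => f (u p.1) * f (u p.2))
      (fun u => ((hfc.comp ((hcu u).comp continuous_fst)).mul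
        (hfc.comp ((hcu u).comp continuous_snd))).measurable)
      (fun p => ((hfc.comp (hev p.1)).mul (hfc.comp (hev p.2))).continuousOn)
      (C := M * M) fun u hu p => ?_
    rw [abs_mul]
    exact mul_le_mul (hM _) (hM _) (abs_nonneg _) hM0

variable {B : CRho ρ → CRho ρ} {φ : ℝ → CRho ρ}

/-- Differentiation of `∫ f(φ) g ρ` along a uniformly bounded solution. -/
theorem hasDerivAt_integral_comp_mul (hf : Differentiable ℝ f) {M : ℝ} (hM : ∀ s, |f s| ≤ M)
    {L : ℝ} (hL : ∀ s, |deriv f s| ≤ L) {ψ : ℝ → CRho ρ} (hφ : ∀ t, HasDerivAt φ (ψ t) t) {D : ℝ}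
    (hψ : ∀ t x, |ψ t x| ≤ D) {g : RN N → ℝ} (hg : Measurable g) {H : ℝ} (hH : ∀ x, |g x| ≤ H)
    (t : ℝ) :
    HasDerivAt (fun t => ∫ x, f (φ t x) * g x * ρ x)
      (∫ x, deriv f (φ t x) * ψ t x * g x * ρ x) t := by
  have hM0 : 0 ≤ M := (abs_nonneg _).trans (hM 0)
  have hL0 : 0 ≤ L := (abs_nonneg _).trans (hL 0)
  have hD0 : 0 ≤ D := (abs_nonneg _).trans (hψ 0 0)
  refine hasDerivAt_integral_mul_weight (C := M * H) (C' := L * D * H) ρ.integrable_toFun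
    (F := fun t x => f (φ t x) * g x) (F' := fun t x => deriv f (φ t x) * ψ t x * g x)
    (fun t => (hf.continuous.measurable.comp (φ t).continuous_coe.measurable).mul hg)
    (fun t => (((measurable_deriv f).comp (φ t).continuous_coe.measurable).mul
      (ψ t).continuous_coe.measurable).mul hg)
    (fun t x => (((hf _).hasDerivAt.comp t
      (hasDerivAt_apply_of_hasDerivAt (hφ t) x)).mul_const (g x)))
    (fun t x => ?_) (fun t x => ?_) t
  · rw [abs_mul]
    exact mul_le_mul (hM _) (hH x) (abs_nonneg _) hM0
  · rw [abs_mul, abs_mul]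
    exact mul_le_mul (mul_le_mul (hL _) (hψ t x) (abs_nonneg _) hL0) (hH x) (abs_nonneg _)
      (mul_nonneg hL0 hD0)

/-- Evenness of `J` makes both halves of the product rule equal, cancelling the `1/2`. What remains
is the integral of `f'(φ) ψ (φ - h - J *_ρ f(φ)) ρ`, and the bracket is `-ψ` by the equation. -/
theorem hasDerivAt_lyapunov (hJ : Integrable J) (hJe : ∀ x, J (-x) = J x)
    (hf : Differentiable ℝ f) {M : ℝ} (hM : ∀ s, |f s| ≤ M) {L : ℝ} (hL : ∀ s, |deriv f s| ≤ L)
    (hh : Continuous h) {H : ℝ} (hH : ∀ x, |h x| ≤ H)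
    (hB : ∀ u x, B u x = convRho J ρ (fun y => f (u y)) x + h x)
    (hφ : ∀ t, HasDerivAt φ (-φ t + B (φ t)) t) {C D : ℝ} (hC : ∀ t x, |φ t x| ≤ C)
    (hD : ∀ t x, |(-φ t + B (φ t) : CRho ρ) x| ≤ D) (t : ℝ) :
    HasDerivAt (fun t => lyapunov J ρ f h (φ t))
      (-∫ x, deriv f (φ t x) * ((-φ t + B (φ t) : CRho ρ) x) ^ 2 * ρ x) t := by
  set ψ : ℝ → CRho ρ := fun t => -φ t + B (φ t) with hψ
  have hM0 : 0 ≤ M := (abs_nonneg _).trans (hM 0)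
  have hL0 : 0 ≤ L := (abs_nonneg _).trans (hL 0)
  have hD0 : 0 ≤ D := (abs_nonneg _).trans (hD 0 0)
  have hH0 : 0 ≤ H := (abs_nonneg _).trans (hH 0)
  have hφx : ∀ t x, HasDerivAt (fun t => φ t x) (ψ t x) t := fun t x =>
    hasDerivAt_apply_of_hasDerivAt (hφ t) x
  have hw : ∀ t x, HasDerivAt (fun t => f (φ t x)) (deriv f (φ t x) * ψ t x) t := fun t x =>
    (hf _).hasDerivAt.comp t (hφx t x)
  have hφm : ∀ t, Measurable fun x => φ t x := fun t => (φ t).continuous_coe.measurable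
  have hwm : ∀ t, Measurable fun x => f (φ t x) := fun t =>
    hf.continuous.measurable.comp (hφm t)
  have hw'm : ∀ t, Measurable fun x => deriv f (φ t x) * ψ t x := fun t =>
    ((measurable_deriv f).comp (hφm t)).mul (ψ t).continuous_coe.measurable
  have hw' : ∀ t x, |deriv f (φ t x) * ψ t x| ≤ L * D := fun t x => by
    rw [abs_mul]; exact mul_le_mul (hL _) (hD t x) (abs_nonneg _) hL0
  have hΨ : Measurable (potential f) := Continuous.measurable <|
    continuous_iff_continuousAt.2 fun s => (hasDerivAt_potential hf s).continuousAt
  have h1 : HasDerivAt (fun t => ∫ x, (potential f (φ t x) - h x * f (φ t x)) * ρ x)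
      (∫ x, (φ t x - h x) * (deriv f (φ t x) * ψ t x) * ρ x) t := by
    refine hasDerivAt_integral_mul_weight ρ.integrable_toFun
      (F := fun t x => potential f (φ t x) - h x * f (φ t x))
      (F' := fun t x => (φ t x - h x) * (deriv f (φ t x) * ψ t x))
      (fun t => (hΨ.comp (hφm t)).sub (hh.measurable.mul (hwm t)))
      (fun t => ((hφm t).sub hh.measurable).mul (hw'm t))
      (fun t x => (((hasDerivAt_potential hf _).comp t (hφx t x)).sub
        ((hw t x).const_mul (h x))).congr_deriv (by ring))
      (C := (C * M + M * C) + H * M) (C' := (C + H) * (L * D)) (fun t x => ?_) (fun t x => ?_) t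
    · refine (abs_sub _ _).trans (add_le_add ((abs_potential_le hM _).trans ?_) ?_)
      · have := hC t x
        gcongr
      · rw [abs_mul]
        exact mul_le_mul (hH x) (hM _) (abs_nonneg _) hH0
    · rw [abs_mul]
      have h2 := (abs_sub (φ t x) (h x)).trans (add_le_add (hC t x) (hH x))
      exact mul_le_mul h2 (hw' t x) (abs_nonneg _) ((abs_nonneg _).trans h2)
  have h2 : HasDerivAt (fun t => ∫ p : RN N × RN N,
        f (φ t p.1) * f (φ t p.2) * interactionWeight J ρ p ∂(volume.prod volume))
      (∫ p : RN N × RN N, ((deriv f (φ t p.1) * ψ t p.1) * f (φ t p.2) +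
        f (φ t p.1) * (deriv f (φ t p.2) * ψ t p.2)) * interactionWeight J ρ p
          ∂(volume.prod volume)) t := by
    refine hasDerivAt_integral_mul_weight (integrable_interactionWeight hJ ρ)
      (F := fun t (p : RN N × RN N) => f (φ t p.1) * f (φ t p.2))
      (F' := fun t (p : RN N × RN N) => (deriv f (φ t p.1) * ψ t p.1) * f (φ t p.2) +
        f (φ t p.1) * (deriv f (φ t p.2) * ψ t p.2))
      (fun t => ((hwm t).comp measurable_fst).mul ((hwm t).comp measurable_snd))
      (fun t => (((hw'm t).comp measurable_fst).mul ((hwm t).comp measurable_snd)).add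
        (((hwm t).comp measurable_fst).mul ((hw'm t).comp measurable_snd)))
      (fun t p => (hw t p.1).mul (hw t p.2))
      (C := M * M) (C' := L * D * M + M * (L * D)) (fun t p => ?_) (fun t p => ?_) t
    · rw [abs_mul]
      exact mul_le_mul (hM _) (hM _) (abs_nonneg _) hM0
    · refine (abs_add_le _ _).trans (add_le_add ?_ ?_)
      · rw [abs_mul]
        exact mul_le_mul (hw' _ _) (hM _) (abs_nonneg _) (mul_nonneg hL0 hD0)
      · rw [abs_mul]
        exact mul_le_mul (hM _) (hw' _ _) (abs_nonneg _) hM0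
  have h3 := integral_mul_interactionWeight (ρ := ρ) hJ (hw'm t) (hwm t) (hw' t)
    (fun x => hM (φ t x))
  have h4 := integral_mul_interactionWeight (ρ := ρ) hJ (hwm t) (hw'm t)
    (fun x => hM (φ t x)) (hw' t)
  have h5 : ∫ p : RN N × RN N, ((deriv f (φ t p.1) * ψ t p.1) * f (φ t p.2) +
        f (φ t p.1) * (deriv f (φ t p.2) * ψ t p.2)) * interactionWeight J ρ p
          ∂(volume.prod volume) =
      2 * ∫ x, deriv f (φ t x) * ψ t x * convRho J ρ (fun y => f (φ t y)) x * ρ x := by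
    simp_rw [add_mul]
    rw [integral_add h3.1 h4.1]
    have hs := integral_mul_interactionWeight_swap (ρ := ρ) hJe (fun x => f (φ t x))
      (fun x => deriv f (φ t x) * ψ t x)
    exact (congrArg₂ (· + ·) h3.2 (hs.trans h3.2)).trans (two_mul _).symm
  rw [h5] at h2
  refine (h1.sub (h2.const_mul (1 / 2))).congr_deriv ?_
  have hcm : Measurable (convRho J ρ fun y => f (φ t y)) :=
    (continuous_convRho hJ (hwm t) (one_mul_weight_le ρ fun y => hM (φ t y))).measurable
  have hi1 : Integrable fun x => (φ t x - h x) * (deriv f (φ t x) * ψ t x) * ρ x :=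
    ρ.integrable_toFun.bdd_mul (c := (C + H) * (L * D))
      (((hφm t).sub hh.measurable).mul (hw'm t)).aestronglyMeasurable
      (Eventually.of_forall fun x => by
        rw [Real.norm_eq_abs, abs_mul]
        have h2 := (abs_sub (φ t x) (h x)).trans (add_le_add (hC t x) (hH x))
        exact mul_le_mul h2 (hw' t x) (abs_nonneg _) ((abs_nonneg _).trans h2))
  have hi2 : Integrable fun x =>
      deriv f (φ t x) * ψ t x * convRho J ρ (fun y => f (φ t y)) x * ρ x :=
    ρ.integrable_toFun.bdd_mul (c := (L * D) * ((∫ y, |J y|) * (M * ρ.supNorm)))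
      ((hw'm t).mul hcm).aestronglyMeasurable
      (Eventually.of_forall fun x => by
        rw [Real.norm_eq_abs, abs_mul]
        exact mul_le_mul (hw' t x)
          (abs_convRho_le hJ (one_mul_weight_le ρ fun y => hM (φ t y)) x) (abs_nonneg _)
          (mul_nonneg hL0 hD0))
  rw [← mul_assoc, one_div, inv_mul_cancel₀ two_ne_zero, one_mul, ← integral_sub hi1 hi2,
    ← integral_neg]
  congr 1; ext x
  have hψx : ψ t x = -φ t x + (convRho J ρ (fun y => f (φ t y)) x + h x) := by
    rw [← hB]; rfl
  rw [show convRho J ρ (fun y => f (φ t y)) x = ψ t x + φ t x - h x by rw [hψx]; ring]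
  ring

/-- Strict monotonicity allows `f'` to vanish, so zero dissipation yields only `f'(φ) ψ = 0` almost
everywhere, that is, `f(φ)` is stationary. Constancy of `f(φ)` in time and injectivity of `f` then
give constancy of `φ`. -/
theorem eq_of_integral_deriv_mul_sq_eq_zero (hf : Differentiable ℝ f) (hmono : StrictMono f)
    {M : ℝ} (hM : ∀ s, |f s| ≤ M) {L : ℝ} (hL : ∀ s, |deriv f s| ≤ L) {ψ : ℝ → CRho ρ}
    (hφ : ∀ t, HasDerivAt φ (ψ t) t) {D : ℝ} (hψ : ∀ t x, |ψ t x| ≤ D)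
    (h0 : ∀ t, ∫ x, deriv f (φ t x) * (ψ t x) ^ 2 * ρ x = 0) (s t : ℝ) : φ s = φ t := by
  have hL0 : 0 ≤ L := (abs_nonneg _).trans (hL 0)
  have hM0 : 0 ≤ M := (abs_nonneg _).trans (hM 0)
  have hae : ∀ t, ∀ᵐ x, deriv f (φ t x) * ψ t x = 0 := by
    intro t
    have hi : Integrable fun x => deriv f (φ t x) * (ψ t x) ^ 2 * ρ x :=
      ρ.integrable_toFun.bdd_mul (c := L * D ^ 2)
        (((measurable_deriv f).comp (φ t).continuous_coe.measurable).mul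
          ((ψ t).continuous_coe.measurable.pow_const 2)).aestronglyMeasurable
        (Eventually.of_forall fun x => by
          rw [Real.norm_eq_abs, abs_mul, abs_pow]
          exact mul_le_mul (hL _) (pow_le_pow_left₀ (abs_nonneg _) (hψ t x) 2)
            (by positivity) hL0)
    have hnn : 0 ≤ fun x => deriv f (φ t x) * (ψ t x) ^ 2 * ρ x := fun x =>
      mul_nonneg (mul_nonneg hmono.monotone.deriv_nonneg (sq_nonneg _)) (ρ.pos x).le
    filter_upwards [(integral_eq_zero_iff_of_nonneg hnn hi).1 (h0 t)] with x hx
    have hx' : deriv f (φ t x) * (ψ t x) ^ 2 * ρ x = 0 := hx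
    have := (mul_eq_zero.1 hx').resolve_right (ρ.pos x).ne'
    rcases mul_eq_zero.1 this with h | h
    · rw [h, zero_mul]
    · rw [pow_eq_zero_iff two_ne_zero] at h; rw [h, mul_zero]
  have hwc : ∀ t, Continuous fun x => f (φ t x) := fun t => hf.continuous.comp (φ t).continuous_coe
  -- The exceptional null set depends on time, so `f(φ)` is tested in integrated form against this
  -- fixed `g`. The pairing is constant in time, and its values at `s` and `t` differ by `∫ g² ρ`.
  set g : RN N → ℝ := fun x => f (φ s x) - f (φ t x) with hg
  have hgc : Continuous g := (hwc s).sub (hwc t)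
  have hgb : ∀ x, |g x| ≤ M + M := fun x => (abs_sub _ _).trans (add_le_add (hM _) (hM _))
  have hd : ∀ r, HasDerivAt (fun r => ∫ x, f (φ r x) * g x * ρ x) 0 r := fun r => by
    refine (hasDerivAt_integral_comp_mul hf hM hL hφ hψ hgc.measurable hgb r).congr_deriv ?_
    refine integral_eq_zero_of_ae ?_
    filter_upwards [hae r] with x hx
    rw [hx]; simp
  have heq : ∫ x, f (φ s x) * g x * ρ x = ∫ x, f (φ t x) * g x * ρ x :=
    is_const_of_deriv_eq_zero (fun r => (hd r).differentiableAt) (fun r => (hd r).deriv) s t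
  have hint : ∀ r, Integrable fun x => f (φ r x) * g x * ρ x := fun r =>
    ρ.integrable_toFun.bdd_mul (c := M * (M + M)) ((hwc r).mul hgc).aestronglyMeasurable
      (Eventually.of_forall fun x => by
        rw [Real.norm_eq_abs, abs_mul]
        exact mul_le_mul (hM _) (hgb x) (abs_nonneg _) hM0)
  have hsq : ∫ x, g x ^ 2 * ρ x = 0 := by
    rw [← sub_eq_zero, ← integral_sub (hint s) (hint t)] at heq
    rw [← heq]
    congr 1; ext x
    simp only [hg]; ring
  have hisq : Integrable fun x => g x ^ 2 * ρ x := by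
    refine ((hint s).sub (hint t)).congr (Eventually.of_forall fun x => ?_)
    simp only [hg, Pi.sub_apply]; ring
  have hz := (integral_eq_zero_iff_of_nonneg
    (fun x => mul_nonneg (sq_nonneg _) (ρ.pos x).le) hisq).1 hsq
  have hz' : (fun x => g x ^ 2 * ρ x) = 0 :=
    (Continuous.ae_eq_iff_eq volume ((hgc.pow 2).mul ρ.continuous_toFun) continuous_zero).1 hz
  refine CRho.ext_apply fun x => hmono.injective (sub_eq_zero.1 ?_)
  have hx : g x ^ 2 * ρ x = 0 := congrFun hz' x
  exact pow_eq_zero_iff two_ne_zero |>.1 ((mul_eq_zero.1 hx).resolve_right (ρ.pos x).ne')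

end Lyapunov

/-! ### Assembly of the main theorem. -/

theorem nonneg_of_abs_le_mul_abs_add {f : ℝ → ℝ} {η K : ℝ} (hf : ∀ s, |f s| ≤ η * |s| + K) :
    0 ≤ η := by
  by_contra! hη
  -- At this point `η * |s| = -(|K| + 1)`, which would make the bound negative.
  have h1 := (abs_nonneg _).trans (hf ((|K| + 1) / η))
  rw [abs_div, abs_of_neg hη, abs_of_nonneg (by positivity : 0 ≤ |K| + 1)] at h1
  have h2 : η * ((|K| + 1) / -η) = -(|K| + 1) := by
    have := hη.ne
    field_simp
  linarith [le_abs_self K]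

theorem mainTheorem2 (N : ℕ)
    (J : RN N → ℝ) (hJ_nonneg : ∀ x, 0 ≤ J x) (hJ_int : Integrable J)
    (hJ_even : ∀ x, J (-x) = J x)
    (ρ : Weight N)
    (h : RN N → ℝ) (hh_cont : Continuous h) (hh_bdd : ∃ C : ℝ, ∀ x, |h x| ≤ C)
    (hh_diff : Differentiable ℝ h) (hh_deriv : ∃ C : ℝ, ∀ x, ‖fderiv ℝ h x‖ ≤ C)
    (f : ℝ → ℝ) (hf_lip : ∃ L : ℝ≥0, LipschitzWith L f) (hf_bdd : ∃ M : ℝ, ∀ s, |f s| ≤ M)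
    (hf_mono : StrictMono f) (hf_diff : Differentiable ℝ f)
    (η K δ R : ℝ) (hf_diss : ∀ s, |f s| ≤ η * |s| + K)
    (hδ : (∫ x, |J x|) * ρ.supNorm * η < δ) (hδ_one : δ < 1)
    (hR : ((∫ x, |J x|) * ρ.supNorm * (K * ρ.supNorm) + ρ.wnorm h) /
      (δ - (∫ x, |J x|) * ρ.supNorm * η) ≤ R) :
    (∃! T : ℝ → CRho ρ → CRho ρ, IsFlow J ρ f h T) ∧
    ∀ T : ℝ → CRho ρ → CRho ρ, IsFlow J ρ f h T →
      IsGlobalAttractor T (omegaLimit atTop T (closedBall (0 : CRho ρ) R)) ∧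
      omegaLimit atTop T (closedBall (0 : CRho ρ) R) =
        unstableSet T (equilibria J ρ f h R) := by
  obtain ⟨H, hH⟩ := hh_bdd
  obtain ⟨L, hL⟩ := hf_lip
  obtain ⟨M, hM⟩ := hf_bdd
  have hK : 0 ≤ K := by simpa using (abs_nonneg _).trans (hf_diss 0)
  have hη : 0 ≤ η := nonneg_of_abs_le_mul_abs_add hf_diss
  have hI : 0 ≤ ∫ x, |J x| := integral_nonneg fun _ => abs_nonneg _
  have hρ := ρ.supNorm_pos
  set a := (∫ x, |J x|) * ρ.supNorm * η with ha
  have ha0 : 0 ≤ a := by positivity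
  have hwn : 0 ≤ ρ.wnorm h := Real.iSup_nonneg fun x => mul_nonneg (abs_nonneg _) (ρ.pos x).le
  set b := (∫ x, |J x|) * ρ.supNorm * (K * ρ.supNorm) + ρ.wnorm h with hb
  have hb0 : 0 ≤ b := by positivity
  -- The a priori bound has denominator `1 - a`, larger than `δ - a`.
  have hbR : b / (1 - a) ≤ R :=
    (div_le_div_of_nonneg_left hb0 (by linarith) (by linarith)).trans hR
  have hderiv : ∀ s, |deriv f s| ≤ L := fun s => norm_deriv_le_of_lipschitz hL
  obtain ⟨B, hB⟩ := exists_nonlocalForcing (ρ := ρ) hJ_int hf_diff.continuous hM hh_cont hH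
  obtain ⟨k, hk⟩ := lipschitzWith_nonlocalForcing hJ_int hM hL hB
  have hF : LipschitzWith (1 + k) fun u : CRho ρ => -u + B u := LipschitzWith.id.neg.add hk
  have hflow : ∀ T : ℝ → CRho ρ → CRho ρ, IsFlow J ρ f h T →
      ∀ u t, HasDerivAt (fun t => T t u) (-T t u + B (T t u)) t := fun T hT u =>
    (isSolution_iff_hasDerivAt hB).1 (hT.solution u)
  refine ⟨?_, fun T hT => ?_⟩
  · choose φ hφ0 hφ using exists_global_solution_neg_add hk
      (norm_nonlocalForcing_le hJ_int hM hH hB)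
    have hφT : IsFlow J ρ f h fun t u => φ u t :=
      ⟨hφ0, fun u => (isSolution_iff_hasDerivAt hB).2 (hφ u)⟩
    refine ⟨fun t u => φ u t, hφT, fun T hT => ?_⟩
    funext t u
    exact congrFun (ODE_solution_unique_univ (v := fun _ u => -u + B u) (s := fun _ => univ)
      (t₀ := 0) (fun _ => hF.lipschitzOnWith) (fun s => ⟨hflow T hT u s, mem_univ _⟩)
      (fun s => ⟨hφ u s, mem_univ _⟩) ((hT.initial u).trans (hφ0 u).symm)) t
  have h0 := hT.initial
  have hTd := hflow T hT
  have hadd := flow_add_of_hasDerivAt hF h0 hTd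
  have hcont := continuous_flow_of_hasDerivAt hF h0 hTd
  have hac : AsymptoticallyCompact T := by
    obtain ⟨p, Q, hQ, hdec⟩ := exists_isCompact_exp_decomposition hJ_int hJ_nonneg
      hf_diff.continuous hM hh_cont hH hB
    refine asymptoticallyCompact_of_exp_decomposition (p := p) hQ fun t ht u => ?_
    have := hdec (fun t => T t u) (hTd u) t ht
    rwa [h0] at this
  have hball : ∀ u, (∃ C, ∀ t, ‖T t u‖ ≤ C) → u ∈ closedBall (0 : CRho ρ) R := by
    rintro u ⟨C, hC⟩
    rw [mem_closedBall_zero_iff]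
    have := norm_le_div_of_bounded_of_hasDerivAt (hTd u) ha0 (hδ.trans hδ_one)
      (fun t => norm_nonlocalForcing_le_affine hJ_int hη hK hf_diss hH hB (T t u)) hC 0
    rw [h0] at this
    exact this.trans hbR
  have hbdd : ∀ S : Set (CRho ρ), Bornology.IsBounded S →
      ∀ u ∈ omegaLimit atTop T S, ∃ C, ∀ t, ‖T t u‖ ≤ C := by
    intro S hS u hu
    obtain ⟨C, hC⟩ := (hac.isCompact_omegaLimit hS).isBounded.exists_norm_le
    exact ⟨C, fun t => hC _ (mapsTo_omegaLimit_of_add hadd hcont S t hu)⟩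
  have hattr : IsGlobalAttractor T (omegaLimit atTop T (closedBall (0 : CRho ρ) R)) :=
    isGlobalAttractor_omegaLimit hac h0 hadd hcont isBounded_closedBall
      fun S hS u hu => hball u (hbdd S hS u hu)
  refine ⟨hattr, Subset.antisymm ?_ ?_⟩
  · set A := omegaLimit atTop T (closedBall (0 : CRho ρ) R)
    have hmaps : ∀ t, MapsTo (T t) A A := mapsTo_omegaLimit_of_add hadd hcont _
    set D := (∫ y, |J y|) * (M * ρ.supNorm) + H
    have hBx : ∀ u x, |B u x| ≤ D := abs_nonlocalForcing_le hJ_int hM hH hB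
    -- At a fixed `x` the orbit is bounded by `C / ρ x`, which depends on `x`; the damped estimate
    -- replaces this by the uniform bound `D` on the forcing.
    have hA : ∀ u ∈ A, ∀ x, |u x| ≤ D := by
      intro u hu x
      obtain ⟨C, hC⟩ := hbdd _ isBounded_closedBall u hu
      have := norm_le_of_bounded_of_hasDerivAt (y := fun t => T t u x)
        (g := fun t => B (T t u) x)
        (fun t => hasDerivAt_apply_of_hasDerivAt (hTd u t) x) (fun t => hBx (T t u) x)
        (C := C / ρ x) (fun t => by
          rw [le_div_iff₀ (ρ.pos x)]
          exact ((T t u).abs_mul_le_norm x).trans (hC t)) 0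
      simp only [h0] at this
      exact this
    have hvel : ∀ u ∈ A, ∀ t x, |(-T t u + B (T t u) : CRho ρ) x| ≤ D + D := fun u hu t x => by
      rw [CRho.add_apply, CRho.neg_apply]
      refine (abs_add_le _ _).trans (add_le_add ?_ (hBx _ x))
      rw [abs_neg]
      exact hA _ (hmaps t hu) x
    have hlyap : ∀ u ∈ A, ∀ t, HasDerivAt (fun t => lyapunov J ρ f h (T t u))
        (-∫ x, deriv f (T t u x) * ((-T t u + B (T t u) : CRho ρ) x) ^ 2 * ρ x) t :=
      fun u hu => hasDerivAt_lyapunov hJ_int hJ_even hf_diff hM hderiv hh_cont hH hB (hTd u)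
        (fun t => hA _ (hmaps t hu)) (hvel u hu)
    refine subset_unstableSet_of_lyapunov hattr.isCompact hadd hcont hmaps
      (continuousOn_lyapunov hJ_int hf_diff hM hh_cont hH hA) (fun u hu => ?_)
      (fun u hu hc => ?_)
    · refine antitone_of_deriv_nonpos (fun t => (hlyap u hu t).differentiableAt) fun t => ?_
      rw [(hlyap u hu t).deriv, neg_nonpos]
      exact integral_nonneg fun x =>
        mul_nonneg (mul_nonneg hf_mono.monotone.deriv_nonneg (sq_nonneg _)) (ρ.pos x).le
    · have hzero : ∀ t, ∫ x, deriv f (T t u x) *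
          ((-T t u + B (T t u) : CRho ρ) x) ^ 2 * ρ x = 0 := fun t => by
        have hconst : (fun t => lyapunov J ρ f h (T t u)) = fun _ => lyapunov J ρ f h (T 0 u) :=
          funext fun s => hc s 0
        have h1 := hlyap u hu t
        rw [hconst] at h1
        exact neg_eq_zero.1 (h1.unique (hasDerivAt_const t _))
      have hfix : ∀ t, T t u = u := fun t =>
        (eq_of_integral_deriv_mul_sq_eq_zero hf_diff hf_mono hM hderiv (hTd u) (hvel u hu)
          hzero t 0).trans (h0 u)
      refine ⟨hball u (hbdd _ isBounded_closedBall u hu), fun x => ?_⟩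
      have h1 := hTd u 0
      simp only [hfix] at h1
      have h2 : -u + B u = 0 := h1.unique (hasDerivAt_const (0 : ℝ) u)
      rw [← hB, ← neg_add_eq_zero.1 h2]
  · exact unstableSet_subset_of_isGlobalAttractor hattr h0 hadd
      (isBounded_closedBall.subset fun u hu => hu.1)
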